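/- Let $\mathfrak g=\mathfrak{gl}(1|1,\mathbb C)\times\mathfrak{gl}(1|1,\mathbb C)$, written as double matrices $\left(\begin{smallmatrix}A&B\\C&D\end{smallmatrix}\middle|\begin{smallmatrix}E&F\\G&H\end{smallmatrix}\right)$. Let $G=(\mathrm{GL}\times\mathrm{GL})^+_{\mathbb C|\mathbb R}(1|1)$ be the cs Lie supergroup whose $T$-valued points, for a cs manifold $T$, are the $T$-valued points of $\mathrm{GL}(1|1,\mathbb C)\times\mathrm{GL}(1|1,\mathbb C)$ with underlying values in $$G_0=\{(\mathrm{diag}(z,r)\,|\,\mathrm{diag}(\bar z^{-1},s)) : z\in\mathbb C^\times,\ r,s>0\}.$$ Let $\theta$ exchange the two blocks, and let $K=\mathrm{UGL}^+_{\mathbb R}(1|1)$ be the subsupergroup of $\theta$-fixed points (with $K_0=\mathrm U(1)\times\mathbb R_{>0}$). Let $\mathfrak a=\mathbb Ch_1\oplus\mathbb Ch_2$ and $\mathfrak a_{\mathbb R}=\mathbb Rh_1\oplus\mathbb Rh_2$ with $h_1=(\mathrm{diag}(1,0)|\mathrm{diag}(-1,0))$ and $h_2=(\mathrm{diag}(0,1)|\mathrm{diag}(0,-1))$,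 and put $h^\pm=h_1\pm h_2$. The restricted roots are $\pm\alpha$, $\alpha(a_1h_1+a_2h_2)=a_1-a_2$; take $\Sigma^+=\{\alpha\}$, so that $m_\alpha=\operatorname{sdim}\mathfrak g^\alpha=-2$ and $\varrho=\tfrac12m_\alpha\alpha=-\alpha$. Let $N$ be the subsupergroup with points $\left(\begin{smallmatrix}1&B\\0&1\end{smallmatrix}\middle|\begin{smallmatrix}1&0\\G&1\end{smallmatrix}\right)$ ($B,G$ odd), let $M=Z_K(\mathfrak a)$, and let $H(g)$, a point of $\mathbb A(\mathfrak a_{\mathbb R})$, be defined by the Iwasawa decomposition $g=k(g)e^{H(g)}n(g)$ with $k(g)\in K$, $n(g)\in N$. For $\lambda\in\mathfrak a^*$ and a $K$-invariant Berezinian density $|D\dot k|$ on $K/M$, let $$\phi_\lambda(g)=\int_{K/M}|D\dot k|\;e^{(\lambda-\varrho)(H(gk))}.$$ Then there is a non-zero $K$-invariant Berezinian density $|D\dot k|$ on $K/M$ such that for all $\lambda\in\mathfrak a^*$ the following hold. 1. For every cs manifold $T$ and every $T$-valued point $h$ of $\mathbb A(\mathfrak a_{\mathbb R})$ (that is, $h=t_1h_1+t_2h_2$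 with even superfunctions $t_1,t_2$ on $T$ with real values), $$\phi_\lambda(e^h)=-\lambda(h^+)\,e^{\lambda(h)}\sinh\alpha(h).$$ 2. The identity $\phi_\lambda(e^{-h})=\phi_\lambda(e^h)$ holds for all such $T$ and $h$ if and only if $\lambda(h^+)=0$. In particular $\phi_\lambda$ is not invariant under $h\mapsto-h$ whenever $\lambda(h^+)\neq0$. 3. Let $h_0=c_+h^++c_-h^-$ with $c_\pm\in\mathbb R$, and let $c(\lambda)=\lim_{t\to\infty}e^{-(\lambda-\varrho)(th_0)}\phi_\lambda(e^{th_0})$. The limit exists if and only if $\lambda(h^+)=0$ or $c_-\ge0$. It equals $0$ if $c_-=0$, and it equals $-\tfrac12\lambda(h^+)$ if $c_->0$. 4. The function $h\mapsto\phi_\lambda(e^h)$ on $\mathfrak a_{\mathbb R}\cong\mathbb R^2$ extends to an entire function on $\mathfrak a\cong\mathbb C^2$. With $\phi_\lambda(e^{th_0})$ understood through this extension, for $h_0=c_+h^++c_-h^-$ with $c_\pm\in\mathbb C$ the limit defining $c(\lambda)$ exists if and only if $\lambda(h^+)=0$ or $c_-=0$ or $\operatorname{Re}c_->0$. It equals $0$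 if $c_-=0$, and it equals $-\tfrac12\lambda(h^+)$ if $\operatorname{Re}c_->0$. -/

import Mathlib

open scoped Manifold ContDiff Topology

namespace GL11

noncomputable section

/-! ### cs manifolds and their superfunctions -/

/-- A finite-dimensional real smooth manifold: the body of a cs manifold. -/
structure SmoothBase where
  dim : ℕ
  carrier : Type
  [top : TopologicalSpace carrier]
  [t2 : T2Space carrier]
  [sc : SecondCountableTopology carrier]
  [charted : ChartedSpace (EuclideanSpace ℝ (Fin dim)) carrier]
  [smooth : IsManifold (𝓡 dim) ∞ carrier]

attribute [instance] SmoothBase.top SmoothBase.t2 SmoothBase.sc SmoothBase.charted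
  SmoothBase.smooth

/-- Multiplication of complex numbers is smooth over `ℝ`; addition is already known to be. -/
instance : ContMDiffRing 𝓘(ℝ, ℂ) ∞ ℂ :=
  { instNormedSpaceLieAddGroup with
    contMDiff_mul := by
      rw [contMDiff_iff]
      refine ⟨continuous_mul, fun x y => ?_⟩
      simp only [mfld_simps, chartAt_self_eq]
      rw [contDiffOn_univ]
      exact contDiff_mul }

/-- The ring `C^∞(M, ℂ)` of smooth complex-valued functions. -/
abbrev SmoothBase.Fun (M : SmoothBase) : Type :=
  ContMDiffMap (𝓡 M.dim) 𝓘(ℝ, ℂ) M.carrier ℂ ∞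

/-- The one-point manifold. -/
def point : SmoothBase where
  dim := 0
  carrier := EuclideanSpace ℝ (Fin 0)

variable (M : SmoothBase) (P : Type) [AddCommGroup P] [Module M.Fun P]

/-- The algebra of global superfunctions of the cs manifold `T` with body `M` and odd coordinate
module `P`, that is `Γ(O_T) = Λ_{C^∞(M,ℂ)} P`.  For `P = C^∞(M,ℂ)^q` this is
`C^∞(M,ℂ) ⊗ Λ(ℂ^q)`; in general `P` is the module of sections of a complex vector bundle on `M`. -/
abbrev Sup : Type := ExteriorAlgebra M.Fun P

/-- The even (`i = 0`) and odd (`i = 1`) superfunctions. -/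
def parity (i : ZMod 2) : Submodule M.Fun (Sup M P) :=
  CliffordAlgebra.evenOdd (0 : QuadraticForm M.Fun P) i

variable {M P}

/-- A complex number as a constant function. -/
def constFun (M : SmoothBase) (c : ℂ) : M.Fun := ContMDiffMap.const c

/-- A complex number as a constant superfunction. -/
def const (c : ℂ) : Sup M P := algebraMap M.Fun (Sup M P) (constFun M c)

/-- The body `f₀ ∈ C^∞(M,ℂ)` of a superfunction. -/
def body (f : Sup M P) : M.Fun := ExteriorAlgebra.algebraMapInv f

/-- The value of a superfunction at a point. -/
def value (x : M.carrier) (f : Sup M P) : ℂ := body f x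

/-- The exponential `x ↦ exp (f x)` of a smooth complex-valued function. -/
def expFun (f : M.Fun) : M.Fun :=
  ⟨fun x => Complex.exp (f x),
    (Complex.contDiff_exp (𝕜 := ℝ) (n := ∞)).contMDiff.comp f.contMDiff⟩

/-- The exponential of a superfunction: with `f = f₀ + n`, `f₀` the body and `n` nilpotent, it is
`e^f = e^{f₀} ∑ₖ nᵏ / k!`. -/
def sexp (f : Sup M P) : Sup M P :=
  let n : Sup M P := f - algebraMap M.Fun (Sup M P) (body f)
  algebraMap M.Fun (Sup M P) (expFun (body f)) *
    ∑ k ∈ Finset.range (nilpotencyClass n), const ((k.factorial : ℂ)⁻¹) * n ^ k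

/-- The hyperbolic sine of a superfunction. -/
def ssinh (f : Sup M P) : Sup M P := const (1 / 2) * (sexp f - sexp (-f))

/-- Odd superfunctions have square zero. -/
theorem odd_sq {f : Sup M P} (hf : f ∈ parity M P 1) : f * f = 0 := by
  have h := CliffordAlgebra.map_mul_map_of_isOrtho_of_mem_evenOdd
    (QuadraticMap.Isometry.id (0 : QuadraticForm M.Fun P))
    (QuadraticMap.Isometry.id (0 : QuadraticForm M.Fun P))
    (fun x y => by simp [QuadraticMap.IsOrtho]) f f hf hf
  rw [CliffordAlgebra.map_id] at h
  have h2 : f * f = -(f * f) := by simpa using h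
  have h3 : f * f + f * f = 0 := by
    nth_rewrite 1 [h2]
    simp
  have h4 : constFun M (1 / 2) + constFun M (1 / 2) = 1 := by
    ext x
    change (1 / 2 : ℂ) + 1 / 2 = 1
    norm_num
  calc f * f = (constFun M (1 / 2) + constFun M (1 / 2)) • (f * f) := by rw [h4, one_smul]
    _ = constFun M (1 / 2) • (f * f + f * f) := by rw [add_smul, smul_add]
    _ = 0 := by rw [h3, smul_zero]

/-! ### The product `T × 𝔸^{0|2}` and the Berezin integral along its second factor -/

/-- The odd coordinate module of `T × 𝔸^{0|2}`. -/
abbrev Odd2 (M : SmoothBase) (P : Type) : Type := P × (Fin 2 → M.Fun)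

/-- Pullback of superfunctions along the projection `T × 𝔸^{0|2} → T`. -/
def pr : Sup M P →ₐ[M.Fun] Sup M (Odd2 M P) :=
  ExteriorAlgebra.map (LinearMap.inl M.Fun P (Fin 2 → M.Fun))

/-- The odd coordinates `ξ₀, ξ₁` of `𝔸^{0|2}`. -/
def xi (i : Fin 2) : Sup M (Odd2 M P) :=
  ExteriorAlgebra.ι M.Fun ((0, Pi.single i 1) : Odd2 M P)

/-- The odd derivation `∂/∂ξᵢ`. -/
def dXi (i : Fin 2) : Sup M (Odd2 M P) →ₗ[M.Fun] Sup M (Odd2 M P) :=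
  CliffordAlgebra.contractLeft
    ((LinearMap.proj i).comp (LinearMap.snd M.Fun P (Fin 2 → M.Fun)))

/-- The Berezin fibre integral `∫ |D(ξ₀,ξ₁)| F` along `T × 𝔸^{0|2} → T`: the coefficient of
`ξ₀ ξ₁` in `F`. -/
def berezin (F : Sup M (Odd2 M P)) : Sup M P :=
  ExteriorAlgebra.map (LinearMap.fst M.Fun P (Fin 2 → M.Fun)) (dXi 1 (dXi 0 F))

/-- The linear map underlying `subst`. -/
def substLin (b c : Sup M (Odd2 M P)) : Odd2 M P →ₗ[M.Fun] Sup M (Odd2 M P) :=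
  ((pr (M := M) (P := P)).toLinearMap.comp (ExteriorAlgebra.ι M.Fun)).comp
      (LinearMap.fst M.Fun P (Fin 2 → M.Fun)) +
    (((LinearMap.proj 0).comp (LinearMap.snd M.Fun P (Fin 2 → M.Fun))).smulRight b +
      ((LinearMap.proj 1).comp (LinearMap.snd M.Fun P (Fin 2 → M.Fun))).smulRight c)

theorem substLin_mem {b c : Sup M (Odd2 M P)} (hb : b ∈ parity M (Odd2 M P) 1)
    (hc : c ∈ parity M (Odd2 M P) 1) (v : Odd2 M P) :
    substLin b c v ∈ parity M (Odd2 M P) 1 := by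
  have h1 : substLin b c v
      = ExteriorAlgebra.ι M.Fun ((v.1, 0) : Odd2 M P) + (v.2 0 • b + v.2 1 • c) := by
    simp [substLin, pr]
  rw [h1]
  exact add_mem (CliffordAlgebra.ι_mem_evenOdd_one _ _)
    (add_mem (Submodule.smul_mem _ _ hb) (Submodule.smul_mem _ _ hc))

/-- Pullback of superfunctions along the morphism `(s, ξ) ↦ (s, (b, c))` from `T × 𝔸^{0|2}` to
itself over `T`, for odd superfunctions `b, c`: it fixes the superfunctions of `T` and sends
`ξ₀ ↦ b`, `ξ₁ ↦ c`. -/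
def subst (b c : Sup M (Odd2 M P)) (hb : b ∈ parity M (Odd2 M P) 1)
    (hc : c ∈ parity M (Odd2 M P) 1) : Sup M (Odd2 M P) →ₐ[M.Fun] Sup M (Odd2 M P) :=
  ExteriorAlgebra.lift M.Fun ⟨substLin b c, fun v => odd_sq (substLin_mem hb hc v)⟩

/-! ### Double matrices and the supergroups `G ⊇ K ⊇ M`, `A`, `N` through their points -/

/-- Double matrices `(A B; C D | E F; G H)`, with blockwise addition and multiplication. -/
abbrev DMat (A : Type) : Type := Matrix (Fin 2) (Fin 2) A × Matrix (Fin 2) (Fin 2) A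

/-- Entrywise application of a function. -/
def DMat.map {A B : Type} (f : A → B) (g : DMat A) : DMat B := (g.1.map f, g.2.map f)

/-- The involution `θ` exchanging the two blocks. -/
def theta {A : Type} (g : DMat A) : DMat A := (g.2, g.1)

variable (M P) in
/-- The `T`-valued points of `GL(1|1,ℂ) × GL(1|1,ℂ)`: invertible pairs of supermatrices with even
diagonal entries and odd off-diagonal entries. -/
def ptsGC : Set (DMat (Sup M P)) :=
  {g | IsUnit g ∧ ∀ i j : Fin 2,
    g.1 i j ∈ parity M P (if i = j then 0 else 1) ∧
    g.2 i j ∈ parity M P (if i = j then 0 else 1)}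

/-- The real form `G₀` of the body of `GL(1|1,ℂ) × GL(1|1,ℂ)`. -/
def G₀ : Set (DMat ℂ) :=
  {g | ∃ (z : ℂ) (r s : ℝ), z ≠ 0 ∧ 0 < r ∧ 0 < s ∧
    g = (!![z, 0; 0, (r : ℂ)], !![(starRingEnd ℂ z)⁻¹, 0; 0, (s : ℂ)])}

variable (M P) in
/-- The `T`-valued points of the cs form `G = (GL × GL)⁺_{ℂ|ℝ}(1|1)` defined by `G₀`: the points
of the complex supergroup whose body takes values in `G₀`. -/
def ptsG : Set (DMat (Sup M P)) :=
  {g | g ∈ ptsGC M P ∧ ∀ x : M.carrier, g.map (value x) ∈ G₀}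

variable (M P) in
/-- The `T`-valued points of `K = UGL⁺_ℝ(1|1)`, the subsupergroup of `θ`-fixed points of `G`.  Its
body consists of the `(diag(z, r), diag(z, r))` with `|z| = 1`, `r > 0`. -/
def ptsK : Set (DMat (Sup M P)) := {k | k ∈ ptsG M P ∧ theta k = k}

/-- The Cartan subspace `𝔞 = 𝔭_ev`: the even (diagonal) elements of `𝔤` with `θ x = -x`. -/
def cartan : Submodule ℂ (DMat ℂ) where
  carrier := {x | (∀ i j, i ≠ j → x.1 i j = 0 ∧ x.2 i j = 0) ∧ theta x = -x}
  zero_mem' := by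
    refine ⟨fun i j _ => ⟨rfl, rfl⟩, ?_⟩
    simp [theta]
  add_mem' := by
    rintro x y ⟨hx, hx'⟩ ⟨hy, hy'⟩
    refine ⟨fun i j h => ?_, ?_⟩
    · simp [hx i j h, hy i j h]
    · rw [neg_add, ← hx', ← hy']
      rfl
  smul_mem' := by
    rintro c x ⟨hx, hx'⟩
    refine ⟨fun i j h => ?_, ?_⟩
    · simp [hx i j h]
    · rw [← smul_neg, ← hx']
      rfl

/-- The element `h₁ = (1 0; 0 0 | -1 0; 0 0)` of `𝔞`. -/
def h₁ : cartan := ⟨(!![1, 0; 0, 0], !![-1, 0; 0, 0]), by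
  refine ⟨fun i j h => ?_, ?_⟩
  · fin_cases i <;> fin_cases j <;> simp_all
  · refine Prod.ext ?_ ?_ <;> ext i j <;> fin_cases i <;> fin_cases j <;> simp [theta]⟩

/-- The element `h₂ = (0 0; 0 1 | 0 0; 0 -1)` of `𝔞`. -/
def h₂ : cartan := ⟨(!![0, 0; 0, 1], !![0, 0; 0, -1]), by
  refine ⟨fun i j h => ?_, ?_⟩
  · fin_cases i <;> fin_cases j <;> simp_all
  · refine Prod.ext ?_ ?_ <;> ext i j <;> fin_cases i <;> fin_cases j <;> simp [theta]⟩

/-- `h⁺ = h₁ + h₂`. -/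
def hPlus : cartan := h₁ + h₂

/-- `h⁻ = h₁ - h₂`. -/
def hMinus : cartan := h₁ - h₂

variable (M P) in
/-- The `T`-valued points of the centraliser `M = Z_K(𝔞)`. -/
def ptsM : Set (DMat (Sup M P)) :=
  {m | m ∈ ptsK M P ∧ ∀ h : cartan,
    m * (h : DMat ℂ).map const = (h : DMat ℂ).map const * m}

variable (M P) in
/-- The `T`-valued points `h = t₁ h₁ + t₂ h₂` of `𝔸(𝔞_ℝ)`: pairs of even superfunctions with real
values. -/
@[ext] structure APt where
  t₁ : Sup M P
  t₂ : Sup M P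
  even₁ : t₁ ∈ parity M P 0
  even₂ : t₂ ∈ parity M P 0
  real₁ : ∀ x, (value x t₁).im = 0
  real₂ : ∀ x, (value x t₂).im = 0

instance : Zero (APt M P) :=
  ⟨⟨0, 0, zero_mem _, zero_mem _, fun x => by simp [value, body], fun x => by simp [value, body]⟩⟩

/-- The symmetry `h ↦ -h` of `𝔸(𝔞_ℝ)`. -/
instance : Neg (APt M P) :=
  ⟨fun h => ⟨-h.t₁, -h.t₂, neg_mem h.even₁, neg_mem h.even₂,
    fun x => by simpa [value, body] using h.real₁ x,
    fun x => by simpa [value, body] using h.real₂ x⟩⟩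

/-- The superfunction `λ(h) = λ(h₁) t₁ + λ(h₂) t₂`, for `λ ∈ 𝔞^*` and a point `h` of `𝔸(𝔞_ℝ)`. -/
def pairing (l : Module.Dual ℂ cartan) (h : APt M P) : Sup M P :=
  const (l h₁) * h.t₁ + const (l h₂) * h.t₂

/-- The point `e^h` of `A ⊆ G`. -/
def expA (h : APt M P) : DMat (Sup M P) :=
  (!![sexp h.t₁, 0; 0, sexp h.t₂], !![sexp (-h.t₁), 0; 0, sexp (-h.t₂)])

variable (M P) in
/-- The `T`-valued points `(1 B; 0 1 | 1 0; G 1)`, with `B` and `G` odd, of the subsupergroup `N`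
with Lie superalgebra `𝔫 = 𝔤^α`. -/
def ptsN : Set (DMat (Sup M P)) :=
  {n | ∃ B ∈ parity M P 1, ∃ G ∈ parity M P 1, n = (!![1, B; 0, 1], !![1, 0; G, 1])}

/-! ### Restricted roots -/

/-- The restricted root `α (a₁ h₁ + a₂ h₂) = a₁ - a₂`. -/
def alpha : Module.Dual ℂ cartan where
  toFun h := (h : DMat ℂ).1 0 0 - (h : DMat ℂ).1 1 1
  map_add' x y := by simp; ring
  map_smul' c x := by simp; ring

/-- The root space `𝔤^β = ⋂_{h ∈ 𝔞} ker (ad h - β(h))`. -/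
def rootSpace (β : Module.Dual ℂ cartan) : Submodule ℂ (DMat ℂ) :=
  ⨅ h : cartan, LinearMap.ker
    (LinearMap.mulLeft ℂ (h : DMat ℂ) - LinearMap.mulRight ℂ (h : DMat ℂ) - β h • LinearMap.id)

/-- The even part of `𝔤` (diagonal blocks). -/
def evenPart : Submodule ℂ (DMat ℂ) where
  carrier := {x | ∀ i j, i ≠ j → x.1 i j = 0 ∧ x.2 i j = 0}
  zero_mem' := fun i j _ => ⟨rfl, rfl⟩
  add_mem' := fun {x y} hx hy i j h => by simp [hx i j h, hy i j h]
  smul_mem' := fun c x hx i j h => by simp [hx i j h]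

/-- The odd part of `𝔤` (antidiagonal blocks). -/
def oddPart : Submodule ℂ (DMat ℂ) where
  carrier := {x | ∀ i, x.1 i i = 0 ∧ x.2 i i = 0}
  zero_mem' := fun i => ⟨rfl, rfl⟩
  add_mem' := fun {x y} hx hy i => by simp [hx i, hy i]
  smul_mem' := fun c x hx i => by simp [hx i]

/-- The multiplicity `m_β = sdim 𝔤^β = dim 𝔤^β_ev - dim 𝔤^β_odd`. -/
def mult (β : Module.Dual ℂ cartan) : ℤ :=
  (Module.finrank ℂ ↥(rootSpace β ⊓ evenPart) : ℤ) -
    (Module.finrank ℂ ↥(rootSpace β ⊓ oddPart) : ℤ)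

/-- `ϱ = ½ ∑_{β ∈ Σ⁺} m_β β` for the positive system `Σ⁺ = {α}`. -/
def rho : Module.Dual ℂ cartan := (1 / 2 : ℂ) • ((mult alpha : ℂ) • alpha)

/-! ### The Iwasawa projection -/

/-- `g = k e^h n` for some `k` in `K` and `n` in `N`. -/
def IsIwasawa (g : DMat (Sup M P)) (h : APt M P) : Prop :=
  ∃ k ∈ ptsK M P, ∃ n ∈ ptsN M P, g = k * expA h * n

open Classical in
/-- The Iwasawa projection `H : G → 𝔸(𝔞_ℝ)`, defined by `g = k(g) e^{H(g)} n(g)`. -/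
def iwasawaH (g : DMat (Sup M P)) : APt M P :=
  if hg : ∃ h : APt M P, IsIwasawa g h then hg.choose else 0

/-! ### The homogeneous superspace `K/M` and its Berezinian densities -/

/-- The section `(b, c) ↦ (1 b; c 1 | 1 b; c 1)` of `K → K/M`.  Since
`(A B; C D) = (1 BD⁻¹; CA⁻¹ 1) diag(A, D)`, it induces an isomorphism `𝔸^{0|2} ≅ K/M`; the resulting
coordinates on `K/M` are denoted by `ξ₀, ξ₁`. -/
def kappa (b c : Sup M P) : DMat (Sup M P) := (!![1, b; c, 1], !![1, b; c, 1])

/-- A Berezinian density `|D(ξ₀,ξ₁)| w` on `K/M ≅ 𝔸^{0|2}`, given by the coefficients of the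
superfunction `w = ∑ᵢⱼ wᵢⱼ ξ₀ⁱ ξ₁ʲ`, `i, j ∈ {0, 1}`. -/
abbrev Density : Type := Fin 2 → Fin 2 → ℂ

/-- The superfunction `w` on `T × K/M`. -/
def Density.coeff (w : Density) : Sup M (Odd2 M P) :=
  ∑ i : Fin 2, ∑ j : Fin 2, const (w i j) * (xi 0 ^ (i : ℕ) * xi 1 ^ (j : ℕ))

/-- The Berezin fibre integral of a superfunction `F` on `T × K/M` against the density. -/
def Density.integral (w : Density) (F : Sup M (Odd2 M P)) : Sup M P := berezin (w.coeff * F)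

/-- `K`-invariance of a Berezinian density `ω` on `K/M`: for every `T`-valued point `k` of `K` and
every superfunction `F` on `T × K/M`, `∫ ω(x) F(k x) = ∫ ω(x) F(x)`.  Here `(b, c)` are the
coordinates of `k x`, `x` being the generic point of `K/M`. -/
def Density.IsInvariant (w : Density) : Prop :=
  ∀ (M : SmoothBase) (P : Type) [AddCommGroup P] [Module M.Fun P] [Module.Finite M.Fun P]
    [Module.Projective M.Fun P], ∀ k ∈ ptsK M P,
    ∃ (b c : Sup M (Odd2 M P)) (hb : b ∈ parity M (Odd2 M P) 1)
      (hc : c ∈ parity M (Odd2 M P) 1), ∃ m ∈ ptsM M (Odd2 M P),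
      k.map pr * kappa (xi 0) (xi 1) = kappa b c * m ∧
      ∀ F : Sup M (Odd2 M P), w.integral (subst b c hb hc F) = w.integral F

/-! ### Spherical superfunctions -/

/-- The spherical superfunction `φ_λ(g) = ∫_{K/M} |D k| e^{(λ - ϱ)(H(g k))}`, on `T`-valued points
`g` of `G`, with respect to the density `w` on `K/M`. -/
def phi (w : Density) (l : Module.Dual ℂ cartan) (g : DMat (Sup M P)) : Sup M P :=
  w.integral (sexp (pairing (l - rho) (iwasawaH (g.map pr * kappa (xi 0) (xi 1)))))

/-- The ordinary point `a₁ h₁ + a₂ h₂` of `𝔞_ℝ`, for real `a₁, a₂`. -/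
def realPt (a₁ a₂ : ℝ) : APt point PUnit where
  t₁ := const a₁
  t₂ := const a₂
  even₁ := SetLike.algebraMap_mem_graded
    (CliffordAlgebra.evenOdd (0 : QuadraticForm point.Fun PUnit)) _
  even₂ := SetLike.algebraMap_mem_graded
    (CliffordAlgebra.evenOdd (0 : QuadraticForm point.Fun PUnit)) _
  real₁ := fun _ => by
    simp only [value, body, const, ExteriorAlgebra.algebraMap_leftInverse _ _]
    exact Complex.ofReal_im _
  real₂ := fun _ => by
    simp only [value, body, const, ExteriorAlgebra.algebraMap_leftInverse _ _]
    exact Complex.ofReal_im _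

/-- The complex number `φ_λ(e^h)` at the ordinary point `h = a₁ h₁ + a₂ h₂` of `𝔞_ℝ`. -/
def phiAt (w : Density) (l : Module.Dual ℂ cartan) (a₁ a₂ : ℝ) : ℂ :=
  value (M := point) (0 : EuclideanSpace ℝ (Fin 0)) (phi w l (expA (realPt a₁ a₂)))

/-- `e^{-(λ-ϱ)(t h₀)} φ_λ(e^{t h₀})` for `h₀ = c₊ h⁺ + c₋ h⁻ ∈ 𝔞_ℝ`, that is for real `c₊, c₋`.  The
value `c(λ)` of the Harish-Chandra `c`-function is the limit of this for `t → ∞`. -/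
def cQuot (w : Density) (l : Module.Dual ℂ cartan) (cp cm t : ℝ) : ℂ :=
  Complex.exp (-(l - rho) ((t : ℂ) • ((cp : ℂ) • hPlus + (cm : ℂ) • hMinus))) *
    phiAt w l (t * (cp + cm)) (t * (cp - cm))

/-- `Φ` is the entire continuation of `a₁ h₁ + a₂ h₂ ↦ φ_λ(e^{a₁ h₁ + a₂ h₂})` from
`𝔞_ℝ ≅ ℝ²` to `𝔞 ≅ ℂ²`. -/
def IsEntireContinuation (w : Density) (l : Module.Dual ℂ cartan) (Φ : ℂ × ℂ → ℂ) : Prop :=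
  Differentiable ℂ Φ ∧ ∀ a₁ a₂ : ℝ, Φ ((a₁ : ℂ), (a₂ : ℂ)) = phiAt w l a₁ a₂

/-- The same expression for arbitrary `h₀ = c₊ h⁺ + c₋ h⁻ ∈ 𝔞` (complex `c₊, c₋`), where `Φ` is the
entire continuation of `h ↦ φ_λ(e^h)`. -/
def cQuotComplex (Φ : ℂ × ℂ → ℂ) (l : Module.Dual ℂ cartan) (cp cm : ℂ) (t : ℝ) : ℂ :=
  Complex.exp (-(l - rho) ((t : ℂ) • (cp • hPlus + cm • hMinus))) *
    Φ ((t : ℂ) * (cp + cm), (t : ℂ) * (cp - cm))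

end

end GL11

open GL11 Filter

/-!
For a point `h` of `𝔸(𝔞_ℝ)`, requiring the `K`-component to be fixed by `θ` determines the Iwasawa
decomposition of `e^h κ(b, c)`: its projection is `h + ½ (1 - e^{-2α(h)}) b c h⁺`. As `(b c)² = 0`
and `ϱ = -α` vanishes on `h⁺`, the integrand of `φ_λ(e^h)` is

  `e^{(λ-ϱ)(h)} (1 + ½ λ(h⁺) (1 - e^{-2α(h)}) ξ₀ ξ₁)`,

and the Berezin integral extracts the coefficient of `ξ₀ ξ₁`, which is `λ(h⁺) e^{λ(h)} sinh α(h)`.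

The projection is unique because `g = k e^h n` with `θ(k) = k` gives `g₂⁻¹ g₁ = n₂⁻¹ e^{2h} n₁`, a
product lower · diagonal · upper with unitriangular outer factors. The density `|D(ξ₀, ξ₁)|` is
invariant because a point `(a B; C d)` of `K` acts by the fractional linear maps
`ξ₀ ↦ (a ξ₀ + B) / (d + C ξ₀)` and `ξ₁ ↦ (d ξ₁ + C) / (a + B ξ₁)`, which are affine as `ξᵢ² = 0` and
have the mutually inverse linear coefficients `Ber (a B; C d)` and `Ber (d C; B a)`.
-/

namespace GL11

noncomputable section

open ExteriorAlgebra (ι)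

/-! ### Rings and complex exponentials -/

section Exponential

variable {A : Type*} [Ring A] [Algebra ℚ A]

theorem eq_zero_of_exp_eq_one {a : A} (ha : IsNilpotent a) (h : IsNilpotent.exp a = 1) :
    a = 0 := by
  obtain ⟨k, hk⟩ := ha
  let s : A := ∑ i ∈ Finset.range k, ((i + 1 + 1).factorial : ℚ)⁻¹ • a ^ i
  have hs : Commute a s :=
    .sum_right _ _ _ fun i _ => ((Commute.refl a).pow_right i).smul_right _
  have hexp : IsNilpotent.exp a = 1 + a * (1 + a * s) := by
    rw [IsNilpotent.exp_eq_sum (k := k + 2) (pow_eq_zero_of_le (by lia) hk),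
      Finset.sum_range_succ', Finset.sum_range_succ']
    simp only [s, mul_add, Finset.mul_sum, mul_smul_comm, pow_succ', pow_zero, mul_one,
      zero_add, Nat.factorial_zero, Nat.factorial_one, Nat.cast_one, inv_one, one_smul]
    abel
  have hunit : IsUnit (1 + a * s) := (hs.isNilpotent_mul_right ⟨k, hk⟩).isUnit_one_add
  exact hunit.mul_left_eq_zero.1 (add_eq_left.1 (hexp.symm.trans h))

end Exponential

section Matrices

variable {A : Type*} [Ring A]

theorem lower_mul_diag_mul_upper (g a d b : A) :
    !![1, 0; g, 1] * !![a, 0; 0, d] * !![1, b; 0, 1] = !![a, a * b; g * a, g * a * b + d] := by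
  simp

theorem diag_eq_of_lower_mul_diag_mul_upper_eq {g a d b g' a' d' b' : A} (ha : IsUnit a)
    (h : !![1, 0; g, 1] * !![a, 0; 0, d] * !![1, b; 0, 1]
      = !![1, 0; g', 1] * !![a', 0; 0, d'] * !![1, b'; 0, 1]) : a = a' ∧ d = d' := by
  simp only [lower_mul_diag_mul_upper, EmbeddingLike.apply_eq_iff_eq, Matrix.vecCons_inj,
    and_true] at h
  obtain ⟨⟨rfl, hb⟩, hg, hd⟩ := h
  obtain rfl := ha.mul_left_cancel hb
  obtain rfl := ha.mul_right_cancel hg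
  exact ⟨rfl, add_left_cancel hd⟩

theorem isUnit_lower (g : A) : IsUnit !![1, 0; g, 1] :=
  ⟨⟨_, !![1, 0; -g, 1], by simp [Matrix.one_fin_two], by simp [Matrix.one_fin_two]⟩, rfl⟩

theorem isUnit_upper (b : A) : IsUnit !![1, b; 0, 1] :=
  ⟨⟨_, !![1, -b; 0, 1], by simp [Matrix.one_fin_two], by simp [Matrix.one_fin_two]⟩, rfl⟩

theorem isUnit_diag (a d : Aˣ) : IsUnit !![(a : A), 0; 0, (d : A)] :=
  ⟨⟨_, !![(a⁻¹ : Aˣ), 0; 0, (d⁻¹ : Aˣ)], by simp [Matrix.one_fin_two],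
    by simp [Matrix.one_fin_two]⟩, rfl⟩

theorem isUnit_of_isUnit_schur {a : Aˣ} {b c d : A} (h : IsUnit (d - c * (a⁻¹ : Aˣ) * b)) :
    IsUnit !![(a : A), b; c, d] := by
  obtain ⟨s, hs⟩ := h
  have hldu := lower_mul_diag_mul_upper (c * (a⁻¹ : Aˣ)) (a : A) s ((a⁻¹ : Aˣ) * b)
  rw [hs, a.mul_inv_cancel_left, a.inv_mul_cancel_right, ← mul_assoc c, add_sub_cancel,
    ← hs] at hldu
  exact hldu ▸ ((isUnit_lower _).mul (isUnit_diag a s)).mul (isUnit_upper _)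

variable {R : Type*} [CommRing R] [Algebra R A]

-- The equation `θ(k) = k` for `k = e^h κ(b, c) n e^{-H}`, with `x = e^{t₁}`, `y = e^{t₂}`.
theorem iwasawa_matrix_identity {x x' y y' σ : R} {b c : A} (hx : x * x' = 1) (hy : y * y' = 1)
    (hσ : 1 - 2 * σ = (x' * y) ^ 2) (hb : b * b = 0) (hc : c * c = 0)
    (hcb : c * b = -(b * c)) :
    !![x • 1, 0; 0, y • 1] * !![1, b; c, 1] * !![1, -((2 * σ) • b); 0, 1]
        * !![x' • (1 - σ • (b * c)), 0; 0, y' • (1 - σ • (b * c))]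
      = !![x' • 1, 0; 0, y' • 1] * !![1, b; c, 1] * !![1, 0; -((2 * σ) • c), 1]
        * !![x • (1 + σ • (b * c)), 0; 0, y • (1 + σ • (b * c))] := by
  have hbbc : b * (b * c) = 0 := by rw [← mul_assoc, hb, zero_mul]
  have hcbc : c * (b * c) = 0 := by
    rw [← mul_assoc, hcb, neg_mul, mul_assoc, hc, mul_zero, neg_zero]
  simp only [Matrix.mul_fin_two, mul_assoc, mul_add, add_mul, mul_sub, mul_one, one_mul,
    mul_zero, zero_mul, add_zero, zero_add, smul_mul_assoc, mul_smul_comm, smul_smul, smul_add,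
    smul_sub, hcb, hbbc, hcbc, smul_zero, smul_neg, mul_neg, neg_mul, neg_zero, neg_neg, sub_zero]
  simp only [EmbeddingLike.apply_eq_iff_eq, Matrix.vecCons_inj, and_true]
  have hentry : x * y' * (1 - 2 * σ) = x' * y := by
    linear_combination x * y' * hσ + x' * y * (y * y' * hx + hy)
  refine ⟨⟨?_, ?_⟩, ?_, ?_⟩ <;> match_scalars <;>
    first | ring1 | linear_combination hentry | linear_combination -hentry

/-- The Berezinian `(a - B d⁻¹ C) d⁻¹` of a supermatrix `(a B; C d)`, in terms of `d' = d⁻¹`. -/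
def berezinian (a d' B C : A) : A := d' * (a - d' * (B * C))

theorem berezinian_mul_berezinian_swap {a a' d d' : R} {B C : A} (ha : a * a' = 1)
    (hd : d * d' = 1) (hC : C * C = 0) (hCB : C * B = -(B * C)) :
    berezinian (algebraMap R A a) (algebraMap R A d') B C
      * berezinian (algebraMap R A d) (algebraMap R A a') C B = 1 := by
  have hCBC : C * (B * C) = 0 := by
    rw [← mul_assoc, hCB, neg_mul, mul_assoc, hC, mul_zero, neg_zero]
  simp only [berezinian, Algebra.algebraMap_eq_smul_one, hCB, mul_sub, sub_mul, mul_assoc,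
    mul_one, one_mul, smul_mul_assoc, mul_smul_comm, smul_smul, smul_sub, hCBC, smul_zero,
    mul_zero, mul_neg]
  match_scalars
  · linear_combination d * d' * ha + hd
  · linear_combination a' * d' * ha - a' * d' * hd

theorem affine_mul_add_eq {a d d' : R} {B C ξ : A} (hd : d * d' = 1) (hξ : ξ * ξ = 0)
    (hξB : ξ * B = -(B * ξ)) (hξC : ξ * C = -(C * ξ)) :
    (algebraMap R A d' * B + ξ * berezinian (algebraMap R A a) (algebraMap R A d') B C)
      * (algebraMap R A d + C * ξ) = algebraMap R A a * ξ + B := by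
  have hξBC : ξ * (B * C) = B * (C * ξ) := by
    rw [← mul_assoc, hξB, neg_mul, mul_assoc, hξC, mul_neg, neg_neg]
  have hξCξ : ξ * (C * ξ) = 0 := by
    rw [← mul_assoc, hξC, neg_mul, mul_assoc, hξ, mul_zero, neg_zero]
  simp only [berezinian, Algebra.algebraMap_eq_smul_one, mul_add, add_mul, mul_sub, sub_mul,
    mul_assoc, mul_one, one_mul, smul_mul_assoc, mul_smul_comm, smul_smul, smul_add, smul_sub,
    hξBC, hξCξ, smul_zero, mul_zero, sub_zero, add_zero]
  match_scalars
  · linear_combination hd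
  · linear_combination a * hd
  · linear_combination -d' * hd

theorem mul_antidiag_eq_antidiag_mul_diag {a b c d x y β γ : A}
    (hβ : β * (d + c * x) = a * x + b) (hγ : γ * (a + b * y) = d * y + c) :
    !![a, b; c, d] * !![1, x; y, 1] = !![1, β; γ, 1] * !![a + b * y, 0; 0, d + c * x] := by
  simp only [Matrix.mul_fin_two, mul_one, one_mul, mul_zero, zero_add, add_zero, hβ, hγ]
  rw [add_comm c, add_comm (c * x)]

end Matrices

section ComplexExponential

theorem exists_ne_zero_cosh_ne_zero (z : ℂ) : ∃ a : ℝ, a ≠ 0 ∧ Complex.cosh (z * a) ≠ 0 := by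
  by_contra! hcosh
  have hone : Complex.cosh z = 0 := by simpa using hcosh 1 one_ne_zero
  have htwo : Complex.cosh (2 * z) = 0 := by simpa [mul_comm] using hcosh 2 two_ne_zero
  have hsinh := Complex.cosh_sq z
  rw [Complex.cosh_two_mul, hone] at htwo
  rw [hone] at hsinh
  have : (1 : ℂ) = 0 := by linear_combination -hsinh - htwo
  exact one_ne_zero this

theorem exp_neg_mul_sinh (z : ℂ) :
    Complex.exp (-z) * Complex.sinh z = 1 / 2 * (1 - Complex.exp (-(2 * z))) := by
  have hmul : Complex.exp (-z) * Complex.exp z = 1 := by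
    rw [← Complex.exp_add, neg_add_cancel, Complex.exp_zero]
  rw [Complex.sinh, two_mul, neg_add, Complex.exp_add (-z)]
  linear_combination 1 / 2 * hmul

theorem tendsto_exp_neg_mul {c : ℂ} (hc : 0 < c.re) :
    Tendsto (fun t : ℝ => Complex.exp (-c * t)) atTop (𝓝 0) := by
  rw [Complex.tendsto_exp_nhds_zero_iff]
  simpa only [Complex.re_mul_ofReal, Complex.neg_re, id_eq] using
    tendsto_id.const_mul_atTop_of_neg (neg_lt_zero.2 hc)

theorem eq_zero_of_exp_mul_eq_one {c : ℂ} (h : ∀ s : ℝ, Complex.exp (c * s) = 1) : c = 0 := by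
  have hderiv : HasDerivAt (fun s : ℝ => Complex.exp (c * s))
      (Complex.exp (c * (0 : ℝ)) * (c * 1)) 0 :=
    ((Complex.ofRealCLM.hasDerivAt (x := (0 : ℝ))).const_mul c).cexp
  simp only [h, one_mul, mul_one] at hderiv
  exact hderiv.unique (hasDerivAt_const _ _)

theorem exists_tendsto_exp_neg_mul_iff (c : ℂ) :
    (∃ L, Tendsto (fun t : ℝ => Complex.exp (-c * t)) atTop (𝓝 L)) ↔ c = 0 ∨ 0 < c.re := by
  constructor
  · rintro ⟨L, hL⟩
    refine or_iff_not_imp_right.2 fun hre => ?_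
    have hnorm : 1 ≤ ‖L‖ := by
      refine ge_of_tendsto hL.norm ?_
      filter_upwards [eventually_ge_atTop 0] with t ht
      rw [Complex.norm_exp, Complex.re_mul_ofReal, Complex.neg_re]
      exact Real.one_le_exp (mul_nonneg (neg_nonneg.2 (not_lt.1 hre)) ht)
    have hL0 : L ≠ 0 := norm_pos_iff.1 (one_pos.trans_le hnorm)
    -- Translating `t` by `s` multiplies the limit by `e^{-cs}`.
    have hperiod (s : ℝ) : Complex.exp (-c * s) = 1 := by
      have hshift : Tendsto (fun t : ℝ => Complex.exp (-c * t) * Complex.exp (-c * s)) atTop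
          (𝓝 L) :=
        (hL.comp (tendsto_atTop_add_const_right atTop s tendsto_id)).congr fun t => by
          simp only [Function.comp_apply, id_eq, Complex.ofReal_add, mul_add, Complex.exp_add]
      exact mul_left_cancel₀ hL0 <|
        (tendsto_nhds_unique (hL.mul_const _) hshift).trans (mul_one L).symm
    exact neg_eq_zero.1 (eq_zero_of_exp_mul_eq_one hperiod)
  · rintro (rfl | hre)
    · exact ⟨1, by simp only [neg_zero, zero_mul, Complex.exp_zero, tendsto_const_nhds]⟩
    · exact ⟨0, tendsto_exp_neg_mul hre⟩

end ComplexExponential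

/-! ### Superfunctions -/

section Superfunctions

variable {M : SmoothBase} {P Q : Type} [AddCommGroup P] [Module M.Fun P]
  [AddCommGroup Q] [Module M.Fun Q]

instance : SetLike.GradedMonoid (parity M P) :=
  inferInstanceAs <| SetLike.GradedMonoid <| CliffordAlgebra.evenOdd (0 : QuadraticForm M.Fun P)

theorem mul_mem_parity {i j k : ZMod 2} {f g : Sup M P} (hf : f ∈ parity M P i)
    (hg : g ∈ parity M P j) (hk : i + j = k := by decide) : f * g ∈ parity M P k :=
  hk ▸ SetLike.mul_mem_graded hf hg

theorem algebraMap_mem_even (r : M.Fun) : algebraMap M.Fun (Sup M P) r ∈ parity M P 0 :=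
  SetLike.algebraMap_mem_graded (parity M P) r

theorem const_mem_even (c : ℂ) : (const c : Sup M P) ∈ parity M P 0 :=
  algebraMap_mem_even _

theorem one_mem_even : (1 : Sup M P) ∈ parity M P 0 :=
  SetLike.one_mem_graded (parity M P)

theorem pow_mem_even {f : Sup M P} (hf : f ∈ parity M P 0) (k : ℕ) : f ^ k ∈ parity M P 0 := by
  simpa only [smul_zero] using SetLike.pow_mem_graded (A := parity M P) k hf

theorem ι_mem_odd (p : P) : ι M.Fun p ∈ parity M P 1 :=
  CliffordAlgebra.ι_mem_evenOdd_one _ p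

theorem commute_of_even {i : ZMod 2} {f g : Sup M P} (hf : f ∈ parity M P 0)
    (hg : g ∈ parity M P i) : Commute f g := by
  simpa only [CliffordAlgebra.map_id, AlgHom.id_apply] using
    CliffordAlgebra.commute_map_mul_map_of_isOrtho_of_mem_evenOdd_zero_left
      (QuadraticMap.Isometry.id (0 : QuadraticForm M.Fun P)) (QuadraticMap.Isometry.id _)
      (fun _ _ => by simp [QuadraticMap.IsOrtho]) f g hf hg

theorem odd_mul_odd {f g : Sup M P} (hf : f ∈ parity M P 1) (hg : g ∈ parity M P 1) :
    f * g = -(g * f) := by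
  simpa only [CliffordAlgebra.map_id, AlgHom.id_apply, neg_mul] using
    CliffordAlgebra.map_mul_map_eq_neg_of_isOrtho_of_mem_evenOdd_one
      (QuadraticMap.Isometry.id (0 : QuadraticForm M.Fun P)) (QuadraticMap.Isometry.id _)
      (fun _ _ => by simp [QuadraticMap.IsOrtho]) f g hf hg

theorem odd_mul_odd_sq {f g : Sup M P} (hf : f ∈ parity M P 1) (hg : g ∈ parity M P 1) :
    f * g * (f * g) = 0 := by
  rw [mul_assoc, ← mul_assoc g f, odd_mul_odd hg hf, neg_mul, mul_neg, ← mul_assoc, ← mul_assoc,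
    odd_sq hf, zero_mul, zero_mul, neg_zero]

theorem map_mem_parity (φ : P →ₗ[M.Fun] Q) {i : ZMod 2} {f : Sup M P} (hf : f ∈ parity M P i) :
    ExteriorAlgebra.map φ f ∈ parity M Q i := by
  have h : (parity M P i).map (ExteriorAlgebra.map φ).toLinearMap ≤ parity M Q i := by
    rw [parity, CliffordAlgebra.evenOdd, Submodule.map_iSup]
    refine iSup_mono fun j => ?_
    rw [Submodule.map_pow]
    gcongr
    rintro _ ⟨_, ⟨p, rfl⟩, rfl⟩
    exact ⟨φ p, (ExteriorAlgebra.map_apply_ι φ p).symm⟩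
  exact h ⟨f, hf, rfl⟩

/-- The constant superfunctions, as a ring homomorphism. -/
def constRingHom (M : SmoothBase) (P : Type) [AddCommGroup P] [Module M.Fun P] :
    ℂ →+* Sup M P :=
  (algebraMap M.Fun (Sup M P)).comp
    { toFun := constFun M
      map_one' := rfl
      map_mul' := fun _ _ => rfl
      map_zero' := rfl
      map_add' := fun _ _ => rfl }

theorem const_add (a b : ℂ) : (const (a + b) : Sup M P) = const a + const b :=
  map_add (constRingHom M P) a b

theorem const_neg (a : ℂ) : (const (-a) : Sup M P) = -const a :=
  map_neg (constRingHom M P) a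

theorem const_zero : (const 0 : Sup M P) = 0 := map_zero (constRingHom M P)

theorem const_one : (const 1 : Sup M P) = 1 := map_one (constRingHom M P)

theorem const_commute (c : ℂ) (f : Sup M P) : Commute (const c) f :=
  Algebra.commutes (constFun M c) f

instance : Algebra ℚ (Sup M P) :=
  ((constRingHom M P).comp (algebraMap ℚ ℂ)).toAlgebra' fun _ f => const_commute _ f

theorem rat_smul_eq (q : ℚ) (f : Sup M P) : q • f = const (q : ℂ) * f := by
  rw [Algebra.smul_def]; rfl

theorem body_add (f g : Sup M P) : body (f + g) = body f + body g :=
  map_add ExteriorAlgebra.algebraMapInv f g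

theorem body_mul (f g : Sup M P) : body (f * g) = body f * body g :=
  map_mul ExteriorAlgebra.algebraMapInv f g

theorem body_algebraMap (r : M.Fun) : body (algebraMap M.Fun (Sup M P) r) = r :=
  ExteriorAlgebra.algebraMap_leftInverse P r

theorem body_one : body (1 : Sup M P) = 1 := map_one ExteriorAlgebra.algebraMapInv

theorem body_ι (p : P) : body (ι M.Fun p) = 0 := by
  simp [body, ExteriorAlgebra.algebraMapInv]

theorem body_map (φ : P →ₗ[M.Fun] Q) (f : Sup M P) : body (ExteriorAlgebra.map φ f) = body f := by
  have h : ExteriorAlgebra.algebraMapInv.comp (ExteriorAlgebra.map φ)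
      = ExteriorAlgebra.algebraMapInv := by
    refine ExteriorAlgebra.hom_ext (LinearMap.ext fun p => ?_)
    change body (ExteriorAlgebra.map φ (ι M.Fun p)) = body (ι M.Fun p)
    rw [ExteriorAlgebra.map_apply_ι, body_ι, body_ι]
  exact DFunLike.congr_fun h f

theorem body_odd {f : Sup M P} (hf : f ∈ parity M P 1) : body f = 0 := by
  refine CliffordAlgebra.odd_induction (Q := (0 : QuadraticForm M.Fun P))
    (P := fun x _ => body (M := M) (P := P) x = 0) body_ι ?_ ?_ f hf
  · intro x y _ _ hx hy
    rw [body_add, hx, hy, add_zero]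
  · intro p q x _ hx
    rw [body_mul, hx, mul_zero]

/-- The value at a point, as a ring homomorphism. -/
def valueHom (x : M.carrier) : Sup M P →+* ℂ where
  toFun := value x
  map_one' := by rw [value, body_one]; rfl
  map_mul' f g := by rw [value, body_mul]; rfl
  map_zero' := by rw [value, body, map_zero]; rfl
  map_add' f g := by rw [value, body_add]; rfl

theorem value_add (x : M.carrier) (f g : Sup M P) : value x (f + g) = value x f + value x g :=
  map_add (valueHom x) f g

theorem value_mul (x : M.carrier) (f g : Sup M P) : value x (f * g) = value x f * value x g :=
  map_mul (valueHom x) f g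

theorem value_neg (x : M.carrier) (f : Sup M P) : value x (-f) = -value x f :=
  map_neg (valueHom x) f

theorem value_sub (x : M.carrier) (f g : Sup M P) : value x (f - g) = value x f - value x g :=
  map_sub (valueHom x) f g

theorem value_one (x : M.carrier) : value x (1 : Sup M P) = 1 := map_one (valueHom x)

theorem value_const (x : M.carrier) (c : ℂ) : value x (const c : Sup M P) = c := by
  rw [value, const, body_algebraMap]; rfl

theorem value_odd (x : M.carrier) {f : Sup M P} (hf : f ∈ parity M P 1) : value x f = 0 := by
  rw [value, body_odd hf]; rfl

theorem value_map (φ : P →ₗ[M.Fun] Q) (x : M.carrier) (f : Sup M P) :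
    value x (ExteriorAlgebra.map φ f) = value x f := by
  rw [value, body_map, value]

/-- The soul of a superfunction: what remains when its body is subtracted. -/
def soul (f : Sup M P) : Sup M P := f - algebraMap M.Fun (Sup M P) (body f)

theorem soul_add (f g : Sup M P) : soul (f + g) = soul f + soul g := by
  rw [soul, soul, soul, body_add, map_add, add_sub_add_comm]

theorem body_soul (f : Sup M P) : body (soul f) = 0 := by
  rw [soul, body, map_sub]
  exact sub_eq_zero.2 (body_algebraMap _).symm

theorem soul_eq_self {f : Sup M P} (hf : body f = 0) : soul f = f := by
  rw [soul, hf, map_zero, sub_zero]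

theorem soul_mem_even {f : Sup M P} (hf : f ∈ parity M P 0) : soul f ∈ parity M P 0 :=
  sub_mem hf (algebraMap_mem_even _)

theorem isNilpotent_soul {f : Sup M P} (hf : f ∈ parity M P 0) : IsNilpotent (soul f) := by
  refine CliffordAlgebra.even_induction (Q := (0 : QuadraticForm M.Fun P))
    (motive := fun x _ => IsNilpotent (soul (M := M) (P := P) x)) ?_ ?_ ?_ f hf
  · intro r
    have hr : soul (algebraMap M.Fun (Sup M P) r) = 0 := by rw [soul, body_algebraMap, sub_self]
    exact hr ▸ IsNilpotent.zero
  · intro x y hx hy hx' hy'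
    rw [soul_add]
    exact (commute_of_even (soul_mem_even hx) (soul_mem_even hy)).isNilpotent_add hx' hy'
  · intro p q x hx _
    have hqx : ι M.Fun q * x ∈ parity M P 1 := mul_mem_parity (ι_mem_odd q) hx
    have hsoul : soul (ι M.Fun p * (ι M.Fun q * x)) = ι M.Fun p * (ι M.Fun q * x) :=
      soul_eq_self (by rw [body_mul, body_ι, zero_mul])
    refine ⟨2, ?_⟩
    rw [sq, mul_assoc]
    exact hsoul.symm ▸ odd_mul_odd_sq (ι_mem_odd p) hqx

theorem expFun_add (f g : M.Fun) : expFun (f + g) = expFun f * expFun g := by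
  ext x
  exact Complex.exp_add (f x) (g x)

theorem expFun_zero : expFun (0 : M.Fun) = 1 :=
  ContMDiffMap.ext fun _ => Complex.exp_zero

theorem sexp_eq (f : Sup M P) :
    sexp f = algebraMap M.Fun (Sup M P) (expFun (body f)) * IsNilpotent.exp (soul f) := by
  rw [sexp, IsNilpotent.exp]
  congr 1
  refine Finset.sum_congr rfl fun k _ => ?_
  rw [rat_smul_eq]
  push_cast
  rfl

theorem sexp_add {f g : Sup M P} (hf : f ∈ parity M P 0) (hg : g ∈ parity M P 0) :
    sexp (f + g) = sexp f * sexp g := by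
  rw [sexp_eq, sexp_eq f, sexp_eq g, soul_add, body_add, expFun_add, map_mul,
    IsNilpotent.exp_add_of_commute (commute_of_even (soul_mem_even hf) (soul_mem_even hg))
      (isNilpotent_soul hf) (isNilpotent_soul hg)]
  exact (Algebra.commute_algebraMap_left _ _).mul_mul_mul_comm _ _

theorem sexp_of_body_eq_zero {f : Sup M P} (hf : body f = 0) :
    sexp f = IsNilpotent.exp f := by
  rw [sexp_eq, hf, expFun_zero, map_one, one_mul, soul_eq_self hf]

theorem sexp_zero : sexp (0 : Sup M P) = 1 := by
  rw [sexp_of_body_eq_zero (map_zero ExteriorAlgebra.algebraMapInv), IsNilpotent.exp_zero]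

theorem sexp_mul_sexp_neg {f : Sup M P} (hf : f ∈ parity M P 0) : sexp f * sexp (-f) = 1 := by
  rw [← sexp_add hf (neg_mem hf), add_neg_cancel, sexp_zero]

theorem sexp_neg_mul_sexp {f : Sup M P} (hf : f ∈ parity M P 0) : sexp (-f) * sexp f = 1 := by
  rw [← sexp_add (neg_mem hf) hf, neg_add_cancel, sexp_zero]

theorem sexp_of_mul_self_eq_zero {f : Sup M P} (hf : body f = 0) (hsq : f * f = 0) :
    sexp f = 1 + f := by
  rw [sexp_of_body_eq_zero hf, IsNilpotent.exp_eq_sum (k := 2) (by rw [sq, hsq])]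
  simp [Finset.sum_range_succ]

theorem sexp_mem_even {f : Sup M P} (hf : f ∈ parity M P 0) : sexp f ∈ parity M P 0 :=
  mul_mem_parity (j := 0) (algebraMap_mem_even _) <| sum_mem fun k _ =>
    mul_mem_parity (const_mem_even _) (pow_mem_even (soul_mem_even hf) k)

theorem sexp_map (φ : P →ₗ[M.Fun] Q) {f : Sup M P} (hf : f ∈ parity M P 0) :
    sexp (ExteriorAlgebra.map φ f) = ExteriorAlgebra.map φ (sexp f) := by
  rw [sexp_eq, sexp_eq, body_map, map_mul, AlgHom.commutes,
    IsNilpotent.map_exp (isNilpotent_soul hf), soul, soul, body_map, map_sub, AlgHom.commutes]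

theorem value_sexp (x : M.carrier) {f : Sup M P} (hf : f ∈ parity M P 0) :
    value x (sexp f) = Complex.exp (value x f) := by
  have hsoul : valueHom x (soul f) = 0 := by
    change body (soul f) x = 0
    rw [body_soul]
    rfl
  change valueHom x (sexp f) = _
  rw [sexp_eq, map_mul, IsNilpotent.map_exp (isNilpotent_soul hf), hsoul, IsNilpotent.exp_zero,
    mul_one]
  change body (algebraMap _ _ _) x = _
  rw [body_algebraMap]
  rfl

theorem sexp_injective {f g : Sup M P} (hf : f ∈ parity M P 0) (hg : g ∈ parity M P 0)
    (hf' : ∀ x, (value x f).im = 0) (hg' : ∀ x, (value x g).im = 0) (h : sexp f = sexp g) :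
    f = g := by
  have hsub : f - g ∈ parity M P 0 := sub_mem hf hg
  have hexp : sexp (f - g) = 1 := by
    rw [sub_eq_add_neg, sexp_add hf (neg_mem hg), h, sexp_mul_sexp_neg hg]
  have hbody : body (f - g) = 0 := by
    ext x
    change value x (f - g) = 0
    obtain ⟨r, hr⟩ : ∃ r : ℝ, value x (f - g) = r :=
      ⟨_, Complex.ext rfl (by rw [value_sub, Complex.sub_im, hf', hg', sub_zero,
        Complex.ofReal_im])⟩
    have hexp_r : Complex.exp r = 1 := by rw [← hr, ← value_sexp x hsub, hexp, value_one]
    rw [hr, (Real.exp_eq_one_iff r).1 (by exact_mod_cast hexp_r), Complex.ofReal_zero]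
  rw [sexp_of_body_eq_zero hbody] at hexp
  exact sub_eq_zero.1 (eq_zero_of_exp_eq_one (soul_eq_self hbody ▸ isNilpotent_soul hsub) hexp)

end Superfunctions

section Berezin

variable {M : SmoothBase} {P : Type} [AddCommGroup P] [Module M.Fun P]

theorem pr_ι (p : P) : pr (ι M.Fun p) = ι M.Fun ((p, 0) : Odd2 M P) :=
  ExteriorAlgebra.map_apply_ι _ p

theorem pr_const (c : ℂ) : pr (const c : Sup M P) = const c :=
  AlgHom.commutes pr _

theorem pr_mem_parity {i : ZMod 2} {f : Sup M P} (hf : f ∈ parity M P i) :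
    pr f ∈ parity M (Odd2 M P) i :=
  map_mem_parity _ hf

theorem value_pr (x : M.carrier) (f : Sup M P) : value x (pr f) = value x f :=
  value_map _ x f

theorem sexp_pr {f : Sup M P} (hf : f ∈ parity M P 0) : sexp (pr f) = pr (sexp f) :=
  sexp_map _ hf

theorem xi_mem_odd (i : Fin 2) : (xi i : Sup M (Odd2 M P)) ∈ parity M (Odd2 M P) 1 :=
  ι_mem_odd _

theorem xi_mul_xi_mul_self (i : Fin 2) (F : Sup M (Odd2 M P)) : xi i * (xi i * F) = 0 := by
  rw [← mul_assoc, odd_sq (xi_mem_odd i), zero_mul]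

theorem xi_one_mul_xi_zero_mul (F : Sup M (Odd2 M P)) :
    xi 1 * (xi 0 * F) = -(xi 0 * (xi 1 * F)) := by
  rw [← mul_assoc, odd_mul_odd (xi_mem_odd 1) (xi_mem_odd 0), neg_mul, mul_assoc]

theorem pr_odd_mul_xi_mul {f : Sup M P} (hf : f ∈ parity M P 1) (i : Fin 2)
    (F : Sup M (Odd2 M P)) : pr f * (xi i * F) = -(xi i * (pr f * F)) := by
  rw [← mul_assoc, odd_mul_odd (pr_mem_parity hf) (xi_mem_odd i), neg_mul, mul_assoc]

theorem pr_even_mul_xi_mul {f : Sup M P} (hf : f ∈ parity M P 0) (i : Fin 2)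
    (F : Sup M (Odd2 M P)) : pr f * (xi i * F) = xi i * (pr f * F) := by
  rw [← mul_assoc, (commute_of_even (pr_mem_parity hf) (xi_mem_odd i)).eq, mul_assoc]

theorem ι_eq_pr_add_xi (v : Odd2 M P) :
    ι M.Fun v = pr (ι M.Fun v.1) + v.2 0 • xi 0 + v.2 1 • xi 1 := by
  rw [pr_ι, xi, xi, ← map_smul, ← map_smul, ← map_add, ← map_add]
  congr 1
  refine Prod.ext (by simp) (funext fun i => ?_)
  fin_cases i <;> simp

theorem dXi_pr (i : Fin 2) (f : Sup M P) : dXi i (pr f) = 0 := by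
  refine CliffordAlgebra.left_induction (Q := (0 : QuadraticForm M.Fun P))
    (P := fun g => dXi i (pr (M := M) (P := P) g) = 0) ?_ ?_ ?_ f
  · intro r
    exact (congrArg (dXi i) (AlgHom.commutes pr r)).trans
      (CliffordAlgebra.contractLeft_algebraMap _ _ r)
  · intro g h hg hh
    rw [map_add, map_add, hg, hh, add_zero]
  · intro g p hg
    change dXi i (pr (ι M.Fun p * g)) = 0
    rw [map_mul, pr_ι]
    refine (CliffordAlgebra.contractLeft_ι_mul _ _ _).trans ?_
    change _ - ι M.Fun ((p, 0) : Odd2 M P) * dXi i (pr g) = 0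
    rw [hg, mul_zero]
    simp

theorem dXi_xi_mul (i j : Fin 2) (F : Sup M (Odd2 M P)) :
    dXi i (xi j * F) = (if i = j then F else 0) - xi j * dXi i F := by
  refine (CliffordAlgebra.contractLeft_ι_mul _ _ _).trans (congrArg (· - _) ?_)
  rcases eq_or_ne i j with rfl | h
  · simp
  · simp [h]

/-- The superfunction `f₀ + ξ₀ f₁ + ξ₁ f₂ + ξ₀ ξ₁ f₃` on `T × 𝔸^{0|2}` with coefficients on `T`. -/
def expansion (f₀ f₁ f₂ f₃ : Sup M P) : Sup M (Odd2 M P) :=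
  pr f₀ + xi 0 * pr f₁ + xi 1 * pr f₂ + xi 0 * (xi 1 * pr f₃)

theorem berezin_expansion (f₀ f₁ f₂ f₃ : Sup M P) : berezin (expansion f₀ f₁ f₂ f₃) = f₃ := by
  have hderiv : dXi 1 (dXi 0 (expansion f₀ f₁ f₂ f₃)) = pr f₃ := by
    simp [expansion, dXi_xi_mul, dXi_pr]
  have hsection : (ExteriorAlgebra.map (LinearMap.fst M.Fun P (Fin 2 → M.Fun))).comp pr
      = AlgHom.id M.Fun (Sup M P) := by
    rw [pr, ExteriorAlgebra.map_comp_map, LinearMap.fst_comp_inl, ExteriorAlgebra.map_id]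
  rw [berezin, hderiv]
  exact DFunLike.congr_fun hsection f₃

theorem ι_mul_expansion (v : Odd2 M P) (f₀ f₁ f₂ f₃ : Sup M P) :
    ι M.Fun v * expansion f₀ f₁ f₂ f₃ = expansion (ι M.Fun v.1 * f₀)
      (v.2 0 • f₀ - ι M.Fun v.1 * f₁) (v.2 1 • f₀ - ι M.Fun v.1 * f₂)
      (v.2 0 • f₂ - v.2 1 • f₁ + ι M.Fun v.1 * f₃) := by
  rw [ι_eq_pr_add_xi]
  simp only [expansion, add_mul, mul_add, map_add, map_sub, map_mul, map_smul, mul_sub,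
    pr_odd_mul_xi_mul (ι_mem_odd v.1), xi_mul_xi_mul_self, xi_one_mul_xi_zero_mul,
    mul_smul_comm, smul_mul_assoc, mul_neg, smul_neg, smul_zero, mul_zero, neg_neg, neg_zero]
  abel

theorem exists_eq_expansion (F : Sup M (Odd2 M P)) :
    ∃ f₀ f₁ f₂ f₃ : Sup M P, F = expansion f₀ f₁ f₂ f₃ := by
  refine CliffordAlgebra.left_induction (Q := (0 : QuadraticForm M.Fun (Odd2 M P)))
    (P := fun F => ∃ f₀ f₁ f₂ f₃ : Sup M P, F = expansion f₀ f₁ f₂ f₃) ?_ ?_ ?_ F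
  · intro r
    refine ⟨algebraMap M.Fun (Sup M P) r, 0, 0, 0, ?_⟩
    simp only [expansion, map_zero, mul_zero, add_zero, AlgHom.commutes]
  · rintro _ _ ⟨f₀, f₁, f₂, f₃, rfl⟩ ⟨g₀, g₁, g₂, g₃, rfl⟩
    refine ⟨f₀ + g₀, f₁ + g₁, f₂ + g₂, f₃ + g₃, ?_⟩
    simp only [expansion, map_add, mul_add]
    abel
  · rintro _ v ⟨f₀, f₁, f₂, f₃, rfl⟩
    exact ⟨_, _, _, _, ι_mul_expansion v f₀ f₁ f₂ f₃⟩

theorem subst_pr {b c : Sup M (Odd2 M P)} (hb : b ∈ parity M (Odd2 M P) 1)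
    (hc : c ∈ parity M (Odd2 M P) 1) (f : Sup M P) : subst b c hb hc (pr f) = pr f := by
  have h : (subst b c hb hc).comp pr = pr := by
    refine ExteriorAlgebra.hom_ext (LinearMap.ext fun p => ?_)
    change subst b c hb hc (pr (ι M.Fun p)) = pr (ι M.Fun p)
    rw [pr_ι, subst, ExteriorAlgebra.lift_ι_apply]
    simp [substLin, pr_ι]
  exact DFunLike.congr_fun h f

theorem subst_xi_zero {b c : Sup M (Odd2 M P)} (hb : b ∈ parity M (Odd2 M P) 1)
    (hc : c ∈ parity M (Odd2 M P) 1) : subst b c hb hc (xi 0) = b := by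
  rw [xi, subst, ExteriorAlgebra.lift_ι_apply]
  simp [substLin]

theorem subst_xi_one {b c : Sup M (Odd2 M P)} (hb : b ∈ parity M (Odd2 M P) 1)
    (hc : c ∈ parity M (Odd2 M P) 1) : subst b c hb hc (xi 1) = c := by
  rw [xi, subst, ExteriorAlgebra.lift_ι_apply]
  simp [substLin]

theorem berezin_subst_affine {β γ p q : Sup M P} (hβ : β ∈ parity M P 1) (hp : p ∈ parity M P 0)
    (hb : pr β + xi 0 * pr p ∈ parity M (Odd2 M P) 1)
    (hc : pr γ + xi 1 * pr q ∈ parity M (Odd2 M P) 1) (F : Sup M (Odd2 M P)) :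
    berezin (subst _ _ hb hc F) = p * q * berezin F := by
  obtain ⟨f₀, f₁, f₂, f₃, rfl⟩ := exists_eq_expansion F
  have hsubst : subst _ _ hb hc (expansion f₀ f₁ f₂ f₃)
      = expansion (f₀ + β * f₁ + γ * f₂ + β * (γ * f₃)) (p * f₁ + p * (γ * f₃))
        (q * f₂ - β * (q * f₃)) (p * q * f₃) := by
    simp only [expansion, map_add, map_mul, map_sub, subst_pr, subst_xi_zero, subst_xi_one,
      add_mul, mul_add, mul_sub, mul_assoc, pr_odd_mul_xi_mul hβ, pr_even_mul_xi_mul hp]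
    abel
  rw [hsubst, berezin_expansion, berezin_expansion]

theorem berezin_pr (f : Sup M P) : berezin (pr f) = 0 := by
  simpa only [expansion, map_zero, mul_zero, add_zero] using berezin_expansion f 0 0 0

theorem berezin_pr_mul_xi_mul_xi {f : Sup M P} (hf : f ∈ parity M P 0) :
    berezin (pr f * (xi 0 * xi 1)) = f := by
  have h := berezin_expansion 0 0 0 f
  rw [expansion, map_zero, mul_zero, mul_zero, zero_add, zero_add, zero_add,
    ← mul_assoc, ← (commute_of_even (pr_mem_parity hf)
      (mul_mem_parity (k := 0) (xi_mem_odd 0) (xi_mem_odd 1))).eq] at h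
  exact h

end Berezin

/-! ### The supergroup `G` and its Iwasawa decomposition -/

section Center

variable {M : SmoothBase} {P : Type} [AddCommGroup P] [Module M.Fun P]

theorem even_mem_center {f : Sup M P} (hf : f ∈ parity M P 0) :
    f ∈ Subring.center (Sup M P) := by
  rw [Subring.mem_center_iff]
  intro g
  obtain ⟨g₀, g₁, hg₀, hg₁, rfl⟩ := Submodule.codisjoint_iff_exists_add_eq.1
    (CliffordAlgebra.evenOdd_isCompl (0 : QuadraticForm M.Fun P)).codisjoint g
  rw [add_mul, mul_add, (commute_of_even hf hg₀).eq, (commute_of_even hf hg₁).eq]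

/-- An even superfunction as an element of the centre, over which all superfunctions form an
algebra. -/
def toCenter (f : Sup M P) (hf : f ∈ parity M P 0) : Subring.center (Sup M P) :=
  ⟨f, even_mem_center hf⟩

theorem toCenter_smul {f : Sup M P} (hf : f ∈ parity M P 0) (g : Sup M P) :
    toCenter f hf • g = f * g := rfl

/-- The inverse of a nowhere vanishing smooth function. -/
def invFun (f : M.Fun) (hf : ∀ x, f x ≠ 0) : M.Fun :=
  ⟨fun x => (f x)⁻¹, fun x =>
    ((contDiffAt_inv ℝ (hf x)).contMDiffAt (n := ∞)).comp x f.contMDiff.contMDiffAt⟩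

theorem mul_invFun (f : M.Fun) (hf : ∀ x, f x ≠ 0) : f * invFun f hf = 1 := by
  ext x
  exact mul_inv_cancel₀ (hf x)

theorem exists_even_inverse {f : Sup M P} (hf : f ∈ parity M P 0) (h : ∀ x, value x f ≠ 0) :
    ∃ g ∈ parity M P 0, f * g = 1 ∧ g * f = 1 := by
  -- Working in the subring of even superfunctions makes the inverse even.
  let even := SetLike.GradeZero.subring (parity M P)
  have hbody : ∀ x, body f x ≠ 0 := h
  let scalar (r : M.Fun) : even := ⟨algebraMap M.Fun (Sup M P) r, algebraMap_mem_even r⟩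
  have hscalar : scalar (body f) * scalar (invFun (body f) hbody) = 1 :=
    Subtype.ext (by rw [Subring.coe_mul, ← map_mul, mul_invFun, map_one]; rfl)
  have hcomm (a b : even) : a * b = b * a := Subtype.ext (commute_of_even a.2 b.2)
  have hunit : IsUnit (scalar (body f)) :=
    ⟨⟨_, _, hscalar, (hcomm _ _).trans hscalar⟩, rfl⟩
  have hnil : IsNilpotent (⟨soul f, soul_mem_even hf⟩ : even) := by
    obtain ⟨n, hn⟩ := isNilpotent_soul hf
    exact ⟨n, Subtype.ext hn⟩
  obtain ⟨u, hu⟩ := hnil.isUnit_add_left_of_commute hunit (hcomm _ _)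
  have huf : (u : even).1 = f := by rw [hu]; exact add_sub_cancel _ f
  refine ⟨(↑u⁻¹ : even).1, (↑u⁻¹ : even).2, ?_, ?_⟩ <;> rw [← huf, ← Subring.coe_mul]
  · rw [u.mul_inv]; rfl
  · rw [u.inv_mul]; rfl

end Center

section Supermatrices

variable {M : SmoothBase} {P : Type} [AddCommGroup P] [Module M.Fun P]

/-- A `(1|1) × (1|1)` supermatrix: even diagonal entries and odd off-diagonal entries. -/
def IsSupermatrix (X : Matrix (Fin 2) (Fin 2) (Sup M P)) : Prop :=
  ∀ i j, X i j ∈ parity M P (if i = j then 0 else 1)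

theorem isSupermatrix_of {a b c d : Sup M P} (ha : a ∈ parity M P 0) (hb : b ∈ parity M P 1)
    (hc : c ∈ parity M P 1) (hd : d ∈ parity M P 0) : IsSupermatrix !![a, b; c, d] := by
  intro i j
  fin_cases i <;> fin_cases j
  exacts [ha, hb, hc, hd]

theorem IsSupermatrix.mul {X Y : Matrix (Fin 2) (Fin 2) (Sup M P)} (hX : IsSupermatrix X)
    (hY : IsSupermatrix Y) : IsSupermatrix (X * Y) := by
  intro i j
  rw [Matrix.mul_apply]
  exact sum_mem fun l _ => mul_mem_parity (hX i l) (hY l j) (by decide +revert)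

theorem IsSupermatrix.map_value {X : Matrix (Fin 2) (Fin 2) (Sup M P)} (hX : IsSupermatrix X)
    (x : M.carrier) : X.map (value x) = !![value x (X 0 0), 0; 0, value x (X 1 1)] := by
  ext i j
  fin_cases i <;> fin_cases j
  exacts [rfl, value_odd x (hX 0 1), value_odd x (hX 1 0), rfl]

theorem IsSupermatrix.isUnit {X : Matrix (Fin 2) (Fin 2) (Sup M P)} (hX : IsSupermatrix X)
    (h : ∀ x i, value x (X i i) ≠ 0) : IsUnit X := by
  obtain ⟨a', ha', haa', ha'a⟩ := exists_even_inverse (hX 0 0) fun x => h x 0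
  have hca' : X 1 0 * a' ∈ parity M P 1 := mul_mem_parity (hX 1 0) ha'
  have hmem : X 1 1 - X 1 0 * a' * X 0 1 ∈ parity M P 0 :=
    sub_mem (hX 1 1) (mul_mem_parity hca' (hX 0 1))
  have hvalue (x : M.carrier) : value x (X 1 1 - X 1 0 * a' * X 0 1) ≠ 0 := by
    rw [value_sub, value_mul, value_odd x (hX 0 1), mul_zero, sub_zero]
    exact h x 1
  obtain ⟨s', -, hss', hs's⟩ := exists_even_inverse hmem hvalue
  rw [Matrix.eta_fin_two X]
  exact isUnit_of_isUnit_schur (a := ⟨X 0 0, a', haa', ha'a⟩) ⟨⟨_, s', hss', hs's⟩, rfl⟩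

theorem mul_mem_G₀ {g g' : DMat ℂ} (hg : g ∈ G₀) (hg' : g' ∈ G₀) : g * g' ∈ G₀ := by
  obtain ⟨z, r, s, hz, hr, hs, rfl⟩ := hg
  obtain ⟨z', r', s', hz', hr', hs', rfl⟩ := hg'
  refine ⟨z * z', r * r', s * s', mul_ne_zero hz hz', mul_pos hr hr', mul_pos hs hs', ?_⟩
  simp [mul_comm]

theorem one_mem_G₀ : ((!![1, 0; 0, 1], !![1, 0; 0, 1]) : DMat ℂ) ∈ G₀ :=
  ⟨1, 1, 1, one_ne_zero, one_pos, one_pos, by simp⟩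

theorem map_value_mul (x : M.carrier) (g g' : DMat (Sup M P)) :
    (g * g').map (value x) = g.map (value x) * g'.map (value x) :=
  Prod.ext (Matrix.map_mul (f := valueHom x)) (Matrix.map_mul (f := valueHom x))

theorem mem_ptsG_iff {g : DMat (Sup M P)} : g ∈ ptsG M P ↔
    IsSupermatrix g.1 ∧ IsSupermatrix g.2 ∧ ∀ x, g.map (value x) ∈ G₀ := by
  refine ⟨fun ⟨⟨_, hg⟩, hx⟩ => ⟨fun i j => (hg i j).1, fun i j => (hg i j).2, hx⟩, ?_⟩
  rintro ⟨h₁, h₂, hx⟩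
  have hdiag (x : M.carrier) (i : Fin 2) : value x (g.1 i i) ≠ 0 ∧ value x (g.2 i i) ≠ 0 := by
    obtain ⟨z, r, s, hz, hr, hs, h⟩ := hx x
    have h1 := congrFun (congrFun (congrArg Prod.fst h) i) i
    have h2 := congrFun (congrFun (congrArg Prod.snd h) i) i
    simp only [DMat.map, Matrix.map_apply] at h1 h2
    rw [h1, h2]
    fin_cases i <;> simp [hz, hr.ne', hs.ne']
  exact ⟨⟨Prod.isUnit_iff.2 ⟨h₁.isUnit fun x i => (hdiag x i).1,
    h₂.isUnit fun x i => (hdiag x i).2⟩, fun i j => ⟨h₁ i j, h₂ i j⟩⟩, hx⟩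

theorem mul_mem_ptsG {g g' : DMat (Sup M P)} (hg : g ∈ ptsG M P) (hg' : g' ∈ ptsG M P) :
    g * g' ∈ ptsG M P := by
  rw [mem_ptsG_iff] at hg hg' ⊢
  exact ⟨hg.1.mul hg'.1, hg.2.1.mul hg'.2.1,
    fun x => map_value_mul x g g' ▸ mul_mem_G₀ (hg.2.2 x) (hg'.2.2 x)⟩

theorem mem_ptsG_of_value_eq_one {g : DMat (Sup M P)} (h₁ : IsSupermatrix g.1)
    (h₂ : IsSupermatrix g.2) (h : ∀ x i, value x (g.1 i i) = 1 ∧ value x (g.2 i i) = 1) :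
    g ∈ ptsG M P := by
  refine mem_ptsG_iff.2 ⟨h₁, h₂, fun x => ?_⟩
  rw [DMat.map, h₁.map_value, h₂.map_value, (h x 0).1, (h x 0).2, (h x 1).1, (h x 1).2]
  exact one_mem_G₀

theorem kappa_mem_ptsG {b c : Sup M P} (hb : b ∈ parity M P 1) (hc : c ∈ parity M P 1) :
    kappa b c ∈ ptsG M P := by
  have h : IsSupermatrix !![1, b; c, 1] := isSupermatrix_of one_mem_even hb hc one_mem_even
  refine mem_ptsG_of_value_eq_one h h fun x i => ?_
  fin_cases i <;> exact ⟨value_one x, value_one x⟩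

theorem mem_ptsG_of_mem_ptsN {n : DMat (Sup M P)} (hn : n ∈ ptsN M P) : n ∈ ptsG M P := by
  obtain ⟨B, hB, G, hG, rfl⟩ := hn
  refine mem_ptsG_of_value_eq_one
    (isSupermatrix_of one_mem_even hB (zero_mem _) one_mem_even)
    (isSupermatrix_of one_mem_even (zero_mem _) hG one_mem_even) fun x i => ?_
  fin_cases i <;> exact ⟨value_one x, value_one x⟩

theorem expA_mem_ptsG (h : APt M P) : expA h ∈ ptsG M P := by
  have hX {s t : Sup M P} (hs : s ∈ parity M P 0) (ht : t ∈ parity M P 0) :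
      IsSupermatrix !![sexp s, 0; 0, sexp t] :=
    isSupermatrix_of (sexp_mem_even hs) (zero_mem _) (zero_mem _) (sexp_mem_even ht)
  have h₁ := hX h.even₁ h.even₂
  have h₂ := hX (neg_mem h.even₁) (neg_mem h.even₂)
  refine mem_ptsG_iff.2 ⟨h₁, h₂, fun x => ?_⟩
  have hreal {t : Sup M P} (ht : t ∈ parity M P 0) (him : (value x t).im = 0) :
      value x (sexp t) = (Real.exp (value x t).re : ℂ) := by
    rw [value_sexp x ht, Complex.ofReal_exp]
    exact congrArg Complex.exp (Complex.ext rfl him)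
  have hneg (t : Sup M P) : (value x (-t)).im = -(value x t).im := by rw [value_neg]; rfl
  refine ⟨Real.exp (value x h.t₁).re, Real.exp (value x h.t₂).re, Real.exp (-(value x h.t₂).re),
    Complex.ofReal_ne_zero.2 (Real.exp_ne_zero _), Real.exp_pos _, Real.exp_pos _, ?_⟩
  rw [DMat.map, expA, h₁.map_value, h₂.map_value]
  simp only [Matrix.of_apply, Matrix.cons_val', Matrix.cons_val_zero, Matrix.cons_val_one,
    Matrix.cons_val_fin_one]
  rw [hreal h.even₁ (h.real₁ x), hreal h.even₂ (h.real₂ x),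
    hreal (neg_mem h.even₁) (by rw [hneg, h.real₁, neg_zero]),
    hreal (neg_mem h.even₂) (by rw [hneg, h.real₂, neg_zero]), value_neg, value_neg,
    Complex.conj_ofReal, ← Complex.ofReal_inv, ← Real.exp_neg]
  rfl

end Supermatrices

section Iwasawa

variable {M : SmoothBase} {P : Type} [AddCommGroup P] [Module M.Fun P]

theorem eq_of_sexp_add_self_eq {f g : Sup M P} (hf : f ∈ parity M P 0) (hg : g ∈ parity M P 0)
    (hf' : ∀ x, (value x f).im = 0) (hg' : ∀ x, (value x g).im = 0)
    (h : sexp (f + f) = sexp (g + g)) : f = g := by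
  have hdouble : f + f = g + g :=
    sexp_injective (add_mem hf hf) (add_mem hg hg)
      (fun x => by rw [value_add, Complex.add_im, hf', add_zero])
      (fun x => by rw [value_add, Complex.add_im, hg', add_zero]) h
  have hhalf (e : Sup M P) : (1 / 2 : ℚ) • (e + e) = e := by module
  rw [← hhalf f, hdouble, hhalf]

theorem sexp_diag_mul {f g f' g' : Sup M P} (hf : f ∈ parity M P 0) (hg : g ∈ parity M P 0)
    (hf' : f' ∈ parity M P 0) (hg' : g' ∈ parity M P 0) :
    !![sexp f, 0; 0, sexp g] * !![sexp f', 0; 0, sexp g']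
      = !![sexp (f + f'), 0; 0, sexp (g + g')] := by
  rw [sexp_add hf hf', sexp_add hg hg']
  simp

theorem expA_neg_mul_expA (h : APt M P) : expA (-h) * expA h = 1 := by
  have hdiag {f g : Sup M P} (hf : f ∈ parity M P 0) (hg : g ∈ parity M P 0) :
      !![sexp (-f), 0; 0, sexp (-g)] * !![sexp f, 0; 0, sexp g] = 1 := by
    rw [sexp_diag_mul (neg_mem hf) (neg_mem hg) hf hg, neg_add_cancel, neg_add_cancel, sexp_zero,
      Matrix.one_fin_two]
  exact Prod.ext (hdiag h.even₁ h.even₂) (hdiag (neg_mem h.even₁) (neg_mem h.even₂))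

theorem IsIwasawa.mem_ptsG {g : DMat (Sup M P)} {h : APt M P} (hg : IsIwasawa g h) :
    g ∈ ptsG M P := by
  obtain ⟨k, hk, n, hn, rfl⟩ := hg
  exact mul_mem_ptsG (mul_mem_ptsG hk.1 (expA_mem_ptsG h)) (mem_ptsG_of_mem_ptsN hn)

theorem IsIwasawa.exists_lower_mul_diag_mul_upper {g : DMat (Sup M P)} {h : APt M P}
    (hg : IsIwasawa g h) : ∃ G B : Sup M P,
      g.1 = g.2 * (!![1, 0; G, 1] * !![sexp (h.t₁ + h.t₁), 0; 0, sexp (h.t₂ + h.t₂)]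
        * !![1, B; 0, 1]) := by
  obtain ⟨k, ⟨-, hθ⟩, _, ⟨B, -, G, -, rfl⟩, rfl⟩ := hg
  have hk : k.2 = k.1 := congrArg Prod.fst hθ
  have hlower : !![1, 0; G, 1] * !![1, 0; -G, 1] = (1 : Matrix (Fin 2) (Fin 2) (Sup M P)) := by
    simp [Matrix.one_fin_two]
  have hdiag : !![sexp (-h.t₁), 0; 0, sexp (-h.t₂)]
      * !![sexp (h.t₁ + h.t₁), 0; 0, sexp (h.t₂ + h.t₂)]
      = !![sexp h.t₁, 0; 0, sexp h.t₂] := by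
    rw [sexp_diag_mul (neg_mem h.even₁) (neg_mem h.even₂) (add_mem h.even₁ h.even₁)
      (add_mem h.even₂ h.even₂), neg_add_cancel_left, neg_add_cancel_left]
  refine ⟨-G, B, ?_⟩
  change k.1 * !![sexp h.t₁, 0; 0, sexp h.t₂] * !![1, B; 0, 1]
    = k.2 * !![sexp (-h.t₁), 0; 0, sexp (-h.t₂)] * !![1, 0; G, 1] * _
  rw [hk, ← hdiag, mul_assoc _ !![1, 0; G, 1], mul_assoc !![1, 0; -G, 1],
    ← mul_assoc !![1, 0; G, 1], hlower, one_mul]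
  simp only [mul_assoc]

theorem IsIwasawa.unique {g : DMat (Sup M P)} {h h' : APt M P} (hg : IsIwasawa g h)
    (hg' : IsIwasawa g h') : h = h' := by
  obtain ⟨G, B, hldu⟩ := hg.exists_lower_mul_diag_mul_upper
  obtain ⟨G', B', hldu'⟩ := hg'.exists_lower_mul_diag_mul_upper
  have hunit : IsUnit g.2 := (Prod.isUnit_iff.1 hg.mem_ptsG.1.1).2
  have h₁ := add_mem h.even₁ h.even₁
  obtain ⟨hd₁, hd₂⟩ := diag_eq_of_lower_mul_diag_mul_upper_eq
    ⟨⟨_, _, sexp_mul_sexp_neg h₁, sexp_neg_mul_sexp h₁⟩, rfl⟩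
    (hunit.mul_left_cancel (hldu.symm.trans hldu'))
  exact APt.ext (eq_of_sexp_add_self_eq h.even₁ h'.even₁ h.real₁ h'.real₁ hd₁)
    (eq_of_sexp_add_self_eq h.even₂ h'.even₂ h.real₂ h'.real₂ hd₂)

theorem iwasawaH_eq {g : DMat (Sup M P)} {h : APt M P} (hg : IsIwasawa g h) :
    iwasawaH g = h := by
  have hex : ∃ h : APt M P, IsIwasawa g h := ⟨h, hg⟩
  rw [iwasawaH, dif_pos hex]
  exact hex.choose_spec.unique hg

theorem isIwasawa_of_theta_eq {g : DMat (Sup M P)} (hg : g ∈ ptsG M P) (h : APt M P)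
    {B G : Sup M P} (hB : B ∈ parity M P 1) (hG : G ∈ parity M P 1)
    (hθ : theta (g * (!![1, B; 0, 1], !![1, 0; G, 1]) * expA (-h))
      = g * (!![1, B; 0, 1], !![1, 0; G, 1]) * expA (-h)) : IsIwasawa g h := by
  have hn : (!![1, B; 0, 1], !![1, 0; G, 1]) ∈ ptsN M P := ⟨B, hB, G, hG, rfl⟩
  refine ⟨_, ⟨mul_mem_ptsG (mul_mem_ptsG hg (mem_ptsG_of_mem_ptsN hn)) (expA_mem_ptsG (-h)), hθ⟩,
    (!![1, -B; 0, 1], !![1, 0; -G, 1]), ⟨_, neg_mem hB, _, neg_mem hG, rfl⟩, ?_⟩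
  have hinv : (!![1, B; 0, 1], !![1, 0; G, 1]) * (!![1, -B; 0, 1], !![1, 0; -G, 1])
      = (1 : DMat (Sup M P)) := by
    ext1 <;> simp [Matrix.one_fin_two]
  rw [mul_assoc _ (expA (-h)), expA_neg_mul_expA, mul_one, mul_assoc, hinv, mul_one]

/-- The coefficient `½ (1 - e^{-2α(h)})`. -/
def iwasawaCoeff (h : APt M P) : Sup M P :=
  const (1 / 2) * (1 - (sexp (-h.t₁) * sexp h.t₂) ^ 2)

theorem iwasawaCoeff_mem_even (h : APt M P) : iwasawaCoeff h ∈ parity M P 0 :=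
  mul_mem_parity (const_mem_even _) (sub_mem one_mem_even (pow_mem_even
    (mul_mem_parity (sexp_mem_even (neg_mem h.even₁)) (sexp_mem_even h.even₂)) 2))

/-- The point `h + s h⁺`, for `s` even with vanishing body. -/
def APt.shift (h : APt M P) (s : Sup M P) (hs : s ∈ parity M P 0) (hbody : body s = 0) :
    APt M P where
  t₁ := h.t₁ + s
  t₂ := h.t₂ + s
  even₁ := add_mem h.even₁ hs
  even₂ := add_mem h.even₂ hs
  real₁ x := by rw [value, body_add, hbody, add_zero]; exact h.real₁ x
  real₂ x := by rw [value, body_add, hbody, add_zero]; exact h.real₂ x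

theorem pairing_shift (l : Module.Dual ℂ cartan) (h : APt M P) {s : Sup M P}
    (hs : s ∈ parity M P 0) (hbody : body s = 0) :
    pairing l (h.shift s hs hbody) = pairing l h + const (l hPlus) * s := by
  rw [hPlus, map_add, const_add, pairing, pairing, APt.shift]
  noncomm_ring

theorem expA_neg (h : APt M P) : expA (-h) = theta (expA h) := by
  change (_, !![sexp (- -h.t₁), 0; 0, sexp (- -h.t₂)]) = _
  rw [neg_neg, neg_neg]
  rfl

theorem expA_shift (h : APt M P) {s : Sup M P} (hs : s ∈ parity M P 0) (hbody : body s = 0)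
    (hsq : s * s = 0) : expA (h.shift s hs hbody) =
      (!![sexp h.t₁ * (1 + s), 0; 0, sexp h.t₂ * (1 + s)],
        !![sexp (-h.t₁) * (1 - s), 0; 0, sexp (-h.t₂) * (1 - s)]) := by
  have hbody_neg : body (-s) = 0 := by rw [body, map_neg]; exact neg_eq_zero.2 hbody
  rw [expA, APt.shift, neg_add, neg_add, sexp_add h.even₁ hs, sexp_add h.even₂ hs,
    sexp_add (neg_mem h.even₁) (neg_mem hs), sexp_add (neg_mem h.even₂) (neg_mem hs),
    sexp_of_mul_self_eq_zero hbody hsq,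
    sexp_of_mul_self_eq_zero hbody_neg (by rw [neg_mul_neg, hsq]), ← sub_eq_add_neg]

theorem one_sub_two_mul_iwasawaCoeff (h : APt M P) :
    1 - 2 * iwasawaCoeff h = (sexp (-h.t₁) * sexp h.t₂) ^ 2 := by
  have hhalf : (2 : Sup M P) * const (1 / 2) = 1 := by
    rw [two_mul, ← const_add, add_halves, const_one]
  rw [iwasawaCoeff, ← mul_assoc, hhalf, one_mul, sub_sub_cancel]

theorem isIwasawa_expA_mul_kappa (h : APt M P) {b c : Sup M P} (hb : b ∈ parity M P 1)
    (hc : c ∈ parity M P 1) (hs : iwasawaCoeff h * (b * c) ∈ parity M P 0)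
    (hbody : body (iwasawaCoeff h * (b * c)) = 0) :
    IsIwasawa (expA h * kappa b c) (h.shift (iwasawaCoeff h * (b * c)) hs hbody) := by
  have hcoeff := iwasawaCoeff_mem_even h
  let σ := toCenter _ hcoeff
  have hodd {f : Sup M P} (hf : f ∈ parity M P 1) : -((2 * σ) • f) ∈ parity M P 1 := by
    rw [two_mul]
    exact neg_mem (mul_mem_parity (add_mem hcoeff hcoeff) hf)
  have hsq : iwasawaCoeff h * (b * c) * (iwasawaCoeff h * (b * c)) = 0 := by
    simpa only [mul_assoc] using odd_mul_odd_sq (mul_mem_parity hcoeff hb) hc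
  have hmatrix := iwasawa_matrix_identity (σ := σ) (x := toCenter _ (sexp_mem_even h.even₁))
    (x' := toCenter _ (sexp_mem_even (neg_mem h.even₁)))
    (y := toCenter _ (sexp_mem_even h.even₂)) (y' := toCenter _ (sexp_mem_even (neg_mem h.even₂)))
    (Subtype.ext (sexp_mul_sexp_neg h.even₁)) (Subtype.ext (sexp_mul_sexp_neg h.even₂))
    (Subtype.ext (one_sub_two_mul_iwasawaCoeff h)) (odd_sq hb) (odd_sq hc) (odd_mul_odd hc hb)
  refine isIwasawa_of_theta_eq (mul_mem_ptsG (expA_mem_ptsG h) (kappa_mem_ptsG hb hc)) _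
    (hodd hb) (hodd hc) ?_
  rw [expA_neg, expA_shift h hs hbody hsq]
  simp only [toCenter_smul, mul_one] at hmatrix
  exact Prod.ext hmatrix.symm hmatrix

end Iwasawa

/-! ### The invariant density on `K/M` -/

section Invariance

variable {M : SmoothBase} {P Q : Type} [AddCommGroup P] [Module M.Fun P]
variable [AddCommGroup Q] [Module M.Fun Q]

/-- The constant density `-|D(ξ₀, ξ₁)|`. -/
def negDensity : Density := ![![-1, 0], ![0, 0]]

theorem negDensity_ne_zero : negDensity ≠ 0 := fun h =>
  neg_ne_zero.2 one_ne_zero (congrFun (congrFun h 0) 0)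

theorem negDensity_integral (F : Sup M (Odd2 M P)) : negDensity.integral F = -berezin F := by
  have hcoeff : (negDensity.coeff : Sup M (Odd2 M P)) = -1 := by
    simp [Density.coeff, negDensity, const_neg, const_one, const_zero]
  simp only [Density.integral, hcoeff, neg_one_mul, berezin, map_neg]

theorem diag_commute_cartan (a d : Sup M P) (h : cartan) :
    ((!![a, 0; 0, d], !![a, 0; 0, d]) : DMat (Sup M P)) * (h : DMat ℂ).map const
      = (h : DMat ℂ).map const * (!![a, 0; 0, d], !![a, 0; 0, d]) := by
  obtain ⟨⟨X, Y⟩, hoff, -⟩ := h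
  have hcomm (Z : Matrix (Fin 2) (Fin 2) ℂ) (h01 : Z 0 1 = 0) (h10 : Z 1 0 = 0) :
      !![a, 0; 0, d] * Z.map (const (M := M) (P := P)) = Z.map const * !![a, 0; 0, d] := by
    rw [Matrix.eta_fin_two (Z.map (const (M := M) (P := P)))]
    simp only [Matrix.map_apply, h01, h10, const_zero, Matrix.mul_fin_two, mul_zero, zero_mul,
      add_zero, zero_add, (const_commute (Z 0 0) a).eq, (const_commute (Z 1 1) d).eq]
  exact Prod.ext (hcomm X (hoff 0 1 zero_ne_one).1 (hoff 1 0 one_ne_zero).1)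
    (hcomm Y (hoff 0 1 zero_ne_one).2 (hoff 1 0 one_ne_zero).2)

theorem diag_mem_ptsM {X : Matrix (Fin 2) (Fin 2) (Sup M P)} (hX : (X, X) ∈ ptsK M P)
    {a d : Sup M Q} (ha : a ∈ parity M Q 0) (hd : d ∈ parity M Q 0)
    (hva : ∀ x, value x a = value x (X 0 0)) (hvd : ∀ x, value x d = value x (X 1 1)) :
    (!![a, 0; 0, d], !![a, 0; 0, d]) ∈ ptsM M Q := by
  obtain ⟨hsuper, -, hval⟩ := mem_ptsG_iff.1 hX.1
  have hdiag : IsSupermatrix !![a, 0; 0, d] := isSupermatrix_of ha (zero_mem _) (zero_mem _) hd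
  refine ⟨⟨mem_ptsG_iff.2 ⟨hdiag, hdiag, fun x => ?_⟩, rfl⟩, diag_commute_cartan a d⟩
  have hmap : Matrix.map !![a, 0; 0, d] (value x) = X.map (value x) := by
    rw [hdiag.map_value, hsuper.map_value, ← hva, ← hvd]
    rfl
  rw [DMat.map, hmap]
  exact hval x

theorem value_diag_ne_zero_of_mem_ptsK {X : Matrix (Fin 2) (Fin 2) (Sup M P)}
    (hX : (X, X) ∈ ptsK M P) (x : M.carrier) : value x (X 0 0) ≠ 0 ∧ value x (X 1 1) ≠ 0 := by
  obtain ⟨z, r, _, hz, hr, -, h⟩ := hX.1.2 x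
  have h₀ : value x (X 0 0) = z := congrFun (congrFun (congrArg Prod.fst h) 0) 0
  have h₁ : value x (X 1 1) = r := congrFun (congrFun (congrArg Prod.fst h) 1) 1
  exact ⟨h₀ ▸ hz, h₁ ▸ Complex.ofReal_ne_zero.2 hr.ne'⟩

theorem berezinian_mem_even {a d' B C : Sup M P} (ha : a ∈ parity M P 0)
    (hd' : d' ∈ parity M P 0) (hB : B ∈ parity M P 1) (hC : C ∈ parity M P 1) :
    berezinian a d' B C ∈ parity M P 0 :=
  mul_mem_parity hd' (sub_mem ha (mul_mem_parity hd' (mul_mem_parity (k := 0) hB hC)))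

theorem berezinian_mul_berezinian_swap_of_even {a a' d d' B C : Sup M P} (ha : a ∈ parity M P 0)
    (ha' : a' ∈ parity M P 0) (hd : d ∈ parity M P 0) (hd' : d' ∈ parity M P 0)
    (hB : B ∈ parity M P 1) (hC : C ∈ parity M P 1) (haa' : a * a' = 1) (hdd' : d * d' = 1) :
    berezinian a d' B C * berezinian d a' C B = 1 :=
  berezinian_mul_berezinian_swap (a := toCenter a ha) (a' := toCenter a' ha')
    (d := toCenter d hd) (d' := toCenter d' hd') (Subtype.ext haa') (Subtype.ext hdd')
    (odd_sq hC) (odd_mul_odd hC hB)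

/-- The coordinate `ξᵢ` transformed by the fractional linear map `ξ ↦ (a ξ + B) / (d + C ξ)`; it is
affine in `ξᵢ`, with the Berezinian of `(a B; C d)` as its linear coefficient. -/
def moebius (a d' B C : Sup M P) (i : Fin 2) : Sup M (Odd2 M P) :=
  pr (d' * B) + xi i * pr (berezinian a d' B C)

theorem moebius_mem_odd {a d' B C : Sup M P} (ha : a ∈ parity M P 0) (hd' : d' ∈ parity M P 0)
    (hB : B ∈ parity M P 1) (hC : C ∈ parity M P 1) (i : Fin 2) :
    moebius a d' B C i ∈ parity M (Odd2 M P) 1 :=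
  add_mem (pr_mem_parity (mul_mem_parity hd' hB))
    (mul_mem_parity (xi_mem_odd i) (pr_mem_parity (berezinian_mem_even ha hd' hB hC)))

theorem moebius_mul {a d d' B C : Sup M P} (ha : a ∈ parity M P 0) (hd : d ∈ parity M P 0)
    (hd' : d' ∈ parity M P 0) (hB : B ∈ parity M P 1) (hC : C ∈ parity M P 1)
    (hdd' : d * d' = 1) (i : Fin 2) :
    moebius a d' B C i * (pr d + pr C * xi i) = pr a * xi i + pr B := by
  have hpr : pr d * pr d' = 1 := by rw [← map_mul, hdd', map_one]
  have h := affine_mul_add_eq (a := toCenter _ (pr_mem_parity ha))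
    (d := toCenter _ (pr_mem_parity hd)) (d' := toCenter _ (pr_mem_parity hd'))
    (Subtype.ext hpr) (odd_sq (xi_mem_odd i)) (odd_mul_odd (xi_mem_odd i) (pr_mem_parity hB))
    (odd_mul_odd (xi_mem_odd i) (pr_mem_parity hC))
  simp only [moebius, berezinian, map_mul, map_sub]
  exact h

theorem pr_map_mul_kappa_eq {a a' d d' B C : Sup M P} (ha : a ∈ parity M P 0)
    (ha' : a' ∈ parity M P 0) (hd : d ∈ parity M P 0) (hd' : d' ∈ parity M P 0)
    (hB : B ∈ parity M P 1) (hC : C ∈ parity M P 1) (haa' : a * a' = 1) (hdd' : d * d' = 1) :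
    DMat.map pr (!![a, B; C, d], !![a, B; C, d]) * kappa (xi 0) (xi 1)
      = kappa (moebius a d' B C 0) (moebius d a' C B 1)
        * (!![pr a + pr B * xi 1, 0; 0, pr d + pr C * xi 0],
          !![pr a + pr B * xi 1, 0; 0, pr d + pr C * xi 0]) := by
  have hmatrix := mul_antidiag_eq_antidiag_mul_diag (moebius_mul ha hd hd' hB hC hdd' 0)
    (moebius_mul hd ha ha' hC hB haa' 1)
  have hmap : Matrix.map !![a, B; C, d] pr = !![pr a, pr B; pr C, pr d] :=
    Matrix.eta_fin_two _
  rw [DMat.map, hmap]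
  exact Prod.ext hmatrix hmatrix

theorem negDensity_isInvariant : negDensity.IsInvariant := by
  rintro M P _ _ _ _ ⟨X, Y⟩ hk
  obtain rfl : Y = X := congrArg Prod.fst hk.2
  obtain ⟨hX, -, -⟩ := mem_ptsG_iff.1 hk.1
  have hvalue := value_diag_ne_zero_of_mem_ptsK hk
  have ha : Y 0 0 ∈ parity M P 0 := hX 0 0
  have hB : Y 0 1 ∈ parity M P 1 := hX 0 1
  have hC : Y 1 0 ∈ parity M P 1 := hX 1 0
  have hd : Y 1 1 ∈ parity M P 0 := hX 1 1
  obtain ⟨a', ha', haa', -⟩ := exists_even_inverse ha fun x => (hvalue x).1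
  obtain ⟨d', hd', hdd', -⟩ := exists_even_inverse hd fun x => (hvalue x).2
  have hb := moebius_mem_odd ha hd' hB hC 0
  have hc := moebius_mem_odd hd ha' hC hB 1
  have hdiag {f g : Sup M P} (hf : f ∈ parity M P 0) (hg : g ∈ parity M P 1) (i : Fin 2) :
      pr f + pr g * xi i ∈ parity M (Odd2 M P) 0 :=
    add_mem (pr_mem_parity hf) (mul_mem_parity (pr_mem_parity hg) (xi_mem_odd i))
  have hvdiag {f g : Sup M P} (hg : g ∈ parity M P 1) (i : Fin 2) (x : M.carrier) :
      value x (pr f + pr g * xi i) = value x f := by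
    rw [value_add, value_mul, value_pr, value_pr, value_odd x hg, zero_mul, add_zero]
  refine ⟨_, _, hb, hc, _, diag_mem_ptsM hk (hdiag ha hB 1) (hdiag hd hC 0) (hvdiag hB 1)
    (hvdiag hC 0), ?_, fun F => ?_⟩
  · rw [← pr_map_mul_kappa_eq ha ha' hd hd' hB hC haa' hdd', ← Matrix.eta_fin_two]
  · rw [negDensity_integral, negDensity_integral]
    refine congrArg Neg.neg ((berezin_subst_affine (mul_mem_parity hd' hB)
      (berezinian_mem_even ha hd' hB hC) hb hc F).trans ?_)
    rw [berezinian_mul_berezinian_swap_of_even ha ha' hd hd' hB hC haa' hdd', one_mul]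

end Invariance

/-! ### Restricted roots and the spherical superfunction -/

section Roots

theorem exists_eq_diagonal_of_cartan (h : cartan) : ∃ u : Fin 2 → ℂ,
    (h : DMat ℂ) = (Matrix.diagonal u, -Matrix.diagonal u) ∧ alpha h = u 0 - u 1 := by
  obtain ⟨⟨X, Y⟩, hoff, hθ⟩ := h
  obtain rfl : Y = -X := congrArg Prod.fst hθ
  have hX : X = Matrix.diagonal fun i => X i i := by
    ext i j
    rcases eq_or_ne i j with rfl | hij
    · rw [Matrix.diagonal_apply_eq]
    · rw [Matrix.diagonal_apply_ne _ hij]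
      exact (hoff i j hij).1
  exact ⟨fun i => X i i, by rw [← hX], rfl⟩

theorem mem_rootSpace_iff {β : Module.Dual ℂ cartan} {x : DMat ℂ} : x ∈ rootSpace β ↔
    ∀ h : cartan, (h : DMat ℂ) * x - x * (h : DMat ℂ) = β h • x := by
  simp only [rootSpace, Submodule.mem_iInf, LinearMap.mem_ker, LinearMap.sub_apply,
    LinearMap.mulLeft_apply, LinearMap.mulRight_apply, LinearMap.smul_apply, LinearMap.id_apply,
    sub_eq_zero]

theorem alpha_h₁ : alpha h₁ = 1 := sub_zero 1

theorem alpha_h₂ : alpha h₂ = -1 := zero_sub 1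

/-- The double matrices `(0 B; 0 0 | 0 0; G 0)` spanning `𝔤^α`. -/
def rootVector : ℂ × ℂ →ₗ[ℂ] DMat ℂ where
  toFun u := (!![0, u.1; 0, 0], !![0, 0; u.2, 0])
  map_add' u v := by simp
  map_smul' c u := by simp

theorem rootVector_injective : Function.Injective rootVector := fun _ _ huv =>
  Prod.ext (congrFun (congrFun (congrArg Prod.fst huv) 0) 1)
    (congrFun (congrFun (congrArg Prod.snd huv) 1) 0)

theorem rootVector_mem_rootSpace (u : ℂ × ℂ) : rootVector u ∈ rootSpace alpha := by
  refine mem_rootSpace_iff.2 fun h => ?_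
  obtain ⟨v, hv, hα⟩ := exists_eq_diagonal_of_cartan h
  rw [hv, hα]
  refine Prod.ext ?_ ?_ <;> ext i j <;>
    simp only [rootVector, LinearMap.coe_mk, AddHom.coe_mk, Prod.mk_mul_mk, Prod.mk_sub_mk,
      Prod.smul_mk, Matrix.sub_apply, Matrix.neg_mul, Matrix.mul_neg, Matrix.neg_apply,
      Matrix.diagonal_mul, Matrix.mul_diagonal, Matrix.smul_apply, smul_eq_mul] <;>
    fin_cases i <;> fin_cases j <;> simp <;> ring

theorem mem_range_rootVector {x : DMat ℂ} (hx : x ∈ rootSpace alpha) :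
    x ∈ LinearMap.range rootVector := by
  have hbracket := mem_rootSpace_iff.1 hx h₁
  rw [alpha_h₁, one_smul] at hbracket
  have hentry₁ (i j : Fin 2) := congrFun (congrFun (congrArg Prod.fst hbracket) i) j
  have hentry₂ (i j : Fin 2) := congrFun (congrFun (congrArg Prod.snd hbracket) i) j
  simp only [h₁, Prod.fst_sub, Prod.fst_mul, Prod.snd_sub, Prod.snd_mul, Matrix.sub_apply,
    Matrix.mul_apply, Fin.sum_univ_two, Fin.forall_fin_two] at hentry₁ hentry₂
  simp only [Fin.isValue, Matrix.of_apply, Matrix.cons_val', Matrix.cons_val_zero,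
    Matrix.cons_val_fin_one, Matrix.cons_val_one, one_mul, mul_one, zero_mul, mul_zero, neg_mul,
    mul_neg, zero_add, add_zero, sub_self, sub_zero, zero_sub, sub_neg_eq_add, and_true, true_and,
    eq_comm (a := (0 : ℂ)), CharZero.neg_eq_self_iff] at hentry₁ hentry₂
  obtain ⟨hb₀₀, hb₁₀, hb₁₁⟩ := hentry₁
  obtain ⟨⟨hg₀₀, hg₀₁⟩, hg₁₁⟩ := hentry₂
  refine ⟨(x.1 0 1, x.2 1 0), Prod.ext ?_ ?_⟩
  · rw [Matrix.eta_fin_two x.1, hb₀₀, hb₁₀, hb₁₁]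
    rfl
  · rw [Matrix.eta_fin_two x.2, hg₀₀, hg₀₁, hg₁₁]
    rfl

theorem rootSpace_alpha : rootSpace alpha = LinearMap.range rootVector :=
  le_antisymm (fun _ => mem_range_rootVector) <| by
    rintro _ ⟨u, rfl⟩
    exact rootVector_mem_rootSpace u

theorem rootSpace_alpha_le_oddPart : rootSpace alpha ≤ oddPart := by
  rw [rootSpace_alpha]
  rintro _ ⟨u, rfl⟩ i
  fin_cases i <;> exact ⟨rfl, rfl⟩

theorem disjoint_oddPart_evenPart : Disjoint oddPart evenPart := by
  refine Submodule.disjoint_def.2 fun x hodd heven => ?_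
  refine Prod.ext ?_ ?_ <;> ext i j <;> rcases eq_or_ne i j with rfl | hij
  exacts [(hodd i).1, (heven i j hij).1, (hodd i).2, (heven i j hij).2]

theorem mult_alpha : mult alpha = -2 := by
  rw [mult, (disjoint_oddPart_evenPart.mono_left rootSpace_alpha_le_oddPart).eq_bot,
    inf_eq_left.2 rootSpace_alpha_le_oddPart, rootSpace_alpha,
    LinearMap.finrank_range_of_inj rootVector_injective]
  simp

theorem rho_eq_neg_alpha : rho = -alpha := by
  rw [rho, mult_alpha, smul_smul]
  norm_num

theorem sub_rho_hPlus (l : Module.Dual ℂ cartan) : (l - rho) hPlus = l hPlus := by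
  rw [rho_eq_neg_alpha, sub_neg_eq_add, LinearMap.add_apply, hPlus, map_add alpha, alpha_h₁,
    alpha_h₂, add_neg_cancel, add_zero]

theorem sub_rho_hMinus (l : Module.Dual ℂ cartan) : (l - rho) hMinus = l hMinus + 2 := by
  rw [rho_eq_neg_alpha, sub_neg_eq_add, LinearMap.add_apply, hMinus, map_sub alpha, alpha_h₁,
    alpha_h₂, sub_neg_eq_add, one_add_one_eq_two]

end Roots

section Spherical

variable {M : SmoothBase} {P : Type} [AddCommGroup P] [Module M.Fun P]

theorem pairing_mem_even (l : Module.Dual ℂ cartan) (h : APt M P) :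
    pairing l h ∈ parity M P 0 :=
  add_mem (mul_mem_parity (const_mem_even _) h.even₁) (mul_mem_parity (const_mem_even _) h.even₂)

theorem pairing_add (l m : Module.Dual ℂ cartan) (h : APt M P) :
    pairing (l + m) h = pairing l h + pairing m h := by
  rw [pairing, pairing, pairing, LinearMap.add_apply, LinearMap.add_apply, const_add, const_add,
    add_mul, add_mul, add_add_add_comm]

theorem pairing_alpha (h : APt M P) : pairing alpha h = h.t₁ - h.t₂ := by
  rw [pairing, alpha_h₁, alpha_h₂, const_neg, const_one, one_mul, neg_one_mul, sub_eq_add_neg]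

/-- The pullback of a point of `𝔸(𝔞_ℝ)` along the projection `T × 𝔸^{0|2} → T`. -/
def APt.pr (h : APt M P) : APt M (Odd2 M P) where
  t₁ := GL11.pr h.t₁
  t₂ := GL11.pr h.t₂
  even₁ := pr_mem_parity h.even₁
  even₂ := pr_mem_parity h.even₂
  real₁ x := by rw [value_pr, h.real₁]
  real₂ x := by rw [value_pr, h.real₂]

theorem pairing_pr (l : Module.Dual ℂ cartan) (h : APt M P) :
    pairing l h.pr = pr (pairing l h) := by
  simp only [pairing, APt.pr, map_add, map_mul, pr_const]

theorem expA_pr (h : APt M P) : (expA h).map pr = expA h.pr := by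
  have map_diag (a d : Sup M P) : !![a, 0; 0, d].map pr = !![pr a, 0; 0, pr d] := by
    ext i j
    fin_cases i <;> fin_cases j <;> simp
  simp only [DMat.map, expA, APt.pr, map_diag, ← map_neg, sexp_pr h.even₁, sexp_pr h.even₂,
    sexp_pr (neg_mem h.even₁), sexp_pr (neg_mem h.even₂)]

theorem iwasawaCoeff_pr (h : APt M P) : iwasawaCoeff h.pr = pr (iwasawaCoeff h) := by
  simp only [iwasawaCoeff, APt.pr, ← map_neg, sexp_pr h.even₂, sexp_pr (neg_mem h.even₁), map_mul,
    map_sub, map_pow, map_one, pr_const]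

theorem sexp_mul_iwasawaCoeff (h : APt M P) :
    sexp (pairing alpha h) * iwasawaCoeff h = ssinh (pairing alpha h) := by
  have hquotient : sexp (-h.t₁) * sexp h.t₂ = sexp (-pairing alpha h) := by
    rw [← sexp_add (neg_mem h.even₁) h.even₂, pairing_alpha, neg_sub, neg_add_eq_sub]
  rw [iwasawaCoeff, ssinh, hquotient, ← mul_assoc, ← (const_commute _ _).eq, mul_assoc, mul_sub,
    mul_one, sq, ← mul_assoc (sexp (pairing alpha h)), sexp_mul_sexp_neg (pairing_mem_even alpha h),
    one_mul]

theorem berezin_pr_mul_one_add {f g : Sup M P} (hf : f ∈ parity M P 0) (hg : g ∈ parity M P 0) :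
    berezin (pr f * (1 + pr g * (xi 0 * xi 1))) = f * g := by
  have hadd (F F' : Sup M (Odd2 M P)) : berezin (F + F') = berezin F + berezin F' := by
    simp only [berezin, map_add]
  rw [mul_add, mul_one, hadd, berezin_pr, zero_add, ← mul_assoc, ← map_mul,
    berezin_pr_mul_xi_mul_xi (mul_mem_parity hf hg)]

theorem body_mul_xi_mul_xi (F : Sup M (Odd2 M P)) : body (F * (xi 0 * xi 1)) = 0 := by
  rw [body_mul, body_mul, body_odd (xi_mem_odd 0), zero_mul, mul_zero]

theorem xi_mul_xi_mem_even : (xi 0 * xi 1 : Sup M (Odd2 M P)) ∈ parity M (Odd2 M P) 0 :=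
  mul_mem_parity (xi_mem_odd 0) (xi_mem_odd 1)

theorem sexp_pr_add_pr_mul_xi_mul_xi {f g : Sup M P} (hf : f ∈ parity M P 0)
    (hg : g ∈ parity M P 0) :
    sexp (pr f + pr g * (xi 0 * xi 1)) = pr (sexp f) * (1 + pr g * (xi 0 * xi 1)) := by
  have hsq : pr g * (xi 0 * xi 1) * (pr g * (xi 0 * xi 1)) = 0 := by
    rw [(commute_of_even (pr_mem_parity hg) xi_mul_xi_mem_even).symm.mul_mul_mul_comm,
      odd_mul_odd_sq (xi_mem_odd 0) (xi_mem_odd 1), mul_zero]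
  rw [sexp_add (pr_mem_parity hf) (mul_mem_parity (pr_mem_parity hg) xi_mul_xi_mem_even),
    sexp_of_mul_self_eq_zero (body_mul_xi_mul_xi _) hsq, sexp_pr hf]

theorem phi_negDensity_expA_eq (l : Module.Dual ℂ cartan) (h : APt M P) :
    phi negDensity l (expA h)
      = -(sexp (pairing (l - rho) h) * (const (l hPlus) * iwasawaCoeff h)) := by
  have hS := pairing_mem_even (l - rho) h
  have hcoeff : const (l hPlus) * iwasawaCoeff h ∈ parity M P 0 :=
    mul_mem_parity (const_mem_even _) (iwasawaCoeff_mem_even h)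
  have hiwasawa := isIwasawa_expA_mul_kappa h.pr (xi_mem_odd 0) (xi_mem_odd 1)
    (mul_mem_parity (iwasawaCoeff_mem_even _) xi_mul_xi_mem_even) (body_mul_xi_mul_xi _)
  rw [phi, expA_pr, iwasawaH_eq hiwasawa, pairing_shift, sub_rho_hPlus, pairing_pr,
    iwasawaCoeff_pr, ← mul_assoc, ← pr_const, ← map_mul, sexp_pr_add_pr_mul_xi_mul_xi hS hcoeff,
    negDensity_integral, berezin_pr_mul_one_add (sexp_mem_even hS) hcoeff]

theorem phi_negDensity_expA (l : Module.Dual ℂ cartan) (h : APt M P) :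
    phi negDensity l (expA h) =
      -(const (l hPlus) * sexp (pairing l h) * ssinh (pairing alpha h)) := by
  rw [phi_negDensity_expA_eq, rho_eq_neg_alpha, sub_neg_eq_add, pairing_add,
    sexp_add (pairing_mem_even l h) (pairing_mem_even alpha h), ← mul_assoc,
    ← (const_commute (l hPlus) _).eq, ← mul_assoc, mul_assoc _ _ (iwasawaCoeff h),
    sexp_mul_iwasawaCoeff]

theorem value_pairing (l : Module.Dual ℂ cartan) (h : APt M P) (x : M.carrier) :
    value x (pairing l h) = l h₁ * value x h.t₁ + l h₂ * value x h.t₂ := by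
  rw [pairing, value_add, value_mul, value_mul, value_const, value_const]

theorem value_ssinh (x : M.carrier) {f : Sup M P} (hf : f ∈ parity M P 0) :
    value x (ssinh f) = Complex.sinh (value x f) := by
  rw [ssinh, value_mul, value_const, value_sub, value_sexp x hf, value_sexp x (neg_mem hf),
    value_neg, Complex.sinh]
  ring

/-- The function `a₁ h₁ + a₂ h₂ ↦ -λ(h⁺) e^{λ(h)} sinh α(h)` on `𝔞 ≅ ℂ²`, the entire continuation
of `h ↦ φ_λ(e^h)`. -/
def phiEntire (l : Module.Dual ℂ cartan) (a : ℂ × ℂ) : ℂ :=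
  -(l hPlus * Complex.exp (l h₁ * a.1 + l h₂ * a.2) * Complex.sinh (a.1 - a.2))

theorem value_phi_negDensity_expA (l : Module.Dual ℂ cartan) (h : APt M P) (x : M.carrier) :
    value x (phi negDensity l (expA h)) = phiEntire l (value x h.t₁, value x h.t₂) := by
  rw [phi_negDensity_expA, value_neg, value_mul, value_mul, value_const,
    value_sexp x (pairing_mem_even l h), value_ssinh x (pairing_mem_even alpha h), pairing_alpha,
    value_sub, value_pairing, phiEntire]

theorem phi_negDensity_expA_neg {l : Module.Dual ℂ cartan} (hl : l hPlus = 0) (h : APt M P) :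
    phi negDensity l (expA (-h)) = phi negDensity l (expA h) := by
  simp only [phi_negDensity_expA, hl, const_zero, zero_mul]

theorem phiAt_negDensity (l : Module.Dual ℂ cartan) (a₁ a₂ : ℝ) :
    phiAt negDensity l a₁ a₂ = phiEntire l (a₁, a₂) :=
  (value_phi_negDensity_expA (M := point) l (realPt a₁ a₂) _).trans <|
    congrArg (phiEntire l) (Prod.ext (value_const _ _) (value_const _ _))

theorem phiEntire_zero_right (l : Module.Dual ℂ cartan) (a : ℂ) :
    phiEntire l (a, 0) = -(l hPlus * Complex.exp (l h₁ * a) * Complex.sinh a) := by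
  rw [phiEntire, mul_zero, add_zero, sub_zero]

theorem hPlus_eq_zero_of_phiEntire_neg {l : Module.Dual ℂ cartan}
    (hsymm : ∀ a : ℝ, phiEntire l (-a, 0) = phiEntire l (a, 0)) : l hPlus = 0 := by
  obtain ⟨a, ha, hcosh⟩ := exists_ne_zero_cosh_ne_zero (l h₁)
  have hsinh : Complex.sinh (a : ℂ) ≠ 0 := by
    rw [← Complex.ofReal_sinh]
    exact_mod_cast Real.sinh_ne_zero.2 ha
  have hprod : l hPlus * (2 * Complex.cosh (l h₁ * a)) * Complex.sinh a = 0 := by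
    have hsymm := hsymm a
    simp only [phiEntire_zero_right, Complex.sinh_neg, mul_neg, neg_neg] at hsymm
    rw [Complex.two_cosh]
    linear_combination hsymm
  simpa [hsinh, hcosh] using hprod

theorem hPlus_eq_zero_of_phi_expA_neg {l : Module.Dual ℂ cartan}
    (hsymm : ∀ h : APt point PUnit,
      phi negDensity l (expA (-h)) = phi negDensity l (expA h)) : l hPlus = 0 := by
  refine hPlus_eq_zero_of_phiEntire_neg fun a => ?_
  obtain ⟨x⟩ : Nonempty point.carrier := ⟨(0 : EuclideanSpace ℝ (Fin 0))⟩
  have hvalue := congrArg (value x) (hsymm (realPt a 0))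
  have hneg₁ : value x (-realPt a 0).t₁ = -a := (value_neg _ _).trans (by rw [realPt, value_const])
  have hneg₂ : value x (-realPt a 0).t₂ = 0 :=
    (value_neg _ _).trans (by rw [realPt, value_const, Complex.ofReal_zero, neg_zero])
  rw [value_phi_negDensity_expA, value_phi_negDensity_expA, hneg₁, hneg₂] at hvalue
  simpa only [realPt, value_const, Complex.ofReal_zero] using hvalue

end Spherical

/-! ### The `c`-function -/

section CFunction

theorem isEntireContinuation_phiEntire (l : Module.Dual ℂ cartan) :
    IsEntireContinuation negDensity l (phiEntire l) :=
  ⟨by unfold phiEntire; fun_prop, fun a₁ a₂ => (phiAt_negDensity l a₁ a₂).symm⟩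

theorem cQuot_negDensity (l : Module.Dual ℂ cartan) (cp cm : ℝ) :
    cQuot negDensity l cp cm = cQuotComplex (phiEntire l) l cp cm := by
  ext t
  rw [cQuot, cQuotComplex, phiAt_negDensity]
  push_cast
  rfl

theorem cQuotComplex_phiEntire (l : Module.Dual ℂ cartan) (cp cm : ℂ) (t : ℝ) :
    cQuotComplex (phiEntire l) l cp cm t
      = -(1 / 2) * l hPlus * (1 - Complex.exp (-(4 * cm) * t)) := by
  set u : ℂ := t * (cp * l hPlus + cm * l hMinus) with hu
  set v : ℂ := 2 * cm * t with hv
  have hexponent : (l - rho) ((t : ℂ) • (cp • hPlus + cm • hMinus)) = u + v := by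
    rw [map_smul, map_add, map_smul, map_smul, sub_rho_hPlus, sub_rho_hMinus, hu, hv]
    simp only [smul_eq_mul]
    ring
  have hphi : phiEntire l (t * (cp + cm), t * (cp - cm)) =
      -(l hPlus * Complex.exp u * Complex.sinh v) := by
    have hu' : l h₁ * (t * (cp + cm)) + l h₂ * (t * (cp - cm)) = u := by
      rw [hu, hPlus, hMinus, map_add, map_sub]
      ring
    have hv' : (t * (cp + cm) - t * (cp - cm) : ℂ) = v := by rw [hv]; ring
    rw [phiEntire, hu', hv']
  calc cQuotComplex (phiEntire l) l cp cm t
      = -l hPlus * (Complex.exp (-u) * Complex.exp u) * (Complex.exp (-v) * Complex.sinh v) := by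
        rw [cQuotComplex, hexponent, hphi, neg_add, Complex.exp_add]
        ring
    _ = -(1 / 2) * l hPlus * (1 - Complex.exp (-(2 * v))) := by
        rw [← Complex.exp_add, neg_add_cancel, Complex.exp_zero, exp_neg_mul_sinh]
        ring
    _ = -(1 / 2) * l hPlus * (1 - Complex.exp (-(4 * cm) * t)) := by
        rw [show -(2 * v) = -(4 * cm) * t by rw [hv]; ring]

theorem tendsto_cQuotComplex (l : Module.Dual ℂ cartan) (cp : ℂ) {cm : ℂ} (hcm : 0 < cm.re) :
    Tendsto (cQuotComplex (phiEntire l) l cp cm) atTop (𝓝 (-(1 / 2) * l hPlus)) := by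
  have hre : 0 < (4 * cm).re := by simpa using hcm
  have hlim := ((tendsto_exp_neg_mul hre).const_sub 1).const_mul (-(1 / 2) * l hPlus)
  rw [sub_zero, mul_one] at hlim
  exact hlim.congr fun t => (cQuotComplex_phiEntire l cp cm t).symm

theorem tendsto_cQuotComplex_zero (l : Module.Dual ℂ cartan) (cp : ℂ) {cm : ℂ}
    (h : l hPlus = 0 ∨ cm = 0) : Tendsto (cQuotComplex (phiEntire l) l cp cm) atTop (𝓝 0) := by
  refine tendsto_const_nhds.congr fun t => ?_
  rw [cQuotComplex_phiEntire]
  rcases h with h | h <;> simp [h]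

theorem exists_tendsto_cQuotComplex_iff (l : Module.Dual ℂ cartan) (cp cm : ℂ) :
    (∃ c : ℂ, Tendsto (cQuotComplex (phiEntire l) l cp cm) atTop (𝓝 c)) ↔
      (l hPlus = 0 ∨ cm = 0 ∨ 0 < cm.re) := by
  constructor
  · rintro ⟨c, hc⟩
    refine or_iff_not_imp_left.2 fun hl => ?_
    have hexp : Tendsto (fun t : ℝ => Complex.exp (-(4 * cm) * t)) atTop
        (𝓝 (1 + 2 / l hPlus * c)) := by
      refine ((hc.const_mul (2 / l hPlus)).const_add 1).congr fun t => ?_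
      rw [cQuotComplex_phiEntire]
      field_simp
      ring
    simpa using (exists_tendsto_exp_neg_mul_iff (4 * cm)).1 ⟨_, hexp⟩
  · rintro (h | h | h)
    · exact ⟨0, tendsto_cQuotComplex_zero l cp (Or.inl h)⟩
    · exact ⟨0, tendsto_cQuotComplex_zero l cp (Or.inr h)⟩
    · exact ⟨_, tendsto_cQuotComplex l cp h⟩

end CFunction

end

end GL11

theorem mainTheorem5 :
    ∃ w : Density, w ≠ 0 ∧ w.IsInvariant ∧ ∀ l : Module.Dual ℂ cartan,
      -- the closed formula, for all `T`-valued points `h` of `𝔸(𝔞_ℝ)`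
      (∀ (M : SmoothBase) (P : Type) [AddCommGroup P] [Module M.Fun P] [Module.Finite M.Fun P]
        [Module.Projective M.Fun P] (h : APt M P),
        phi w l (expA h) =
          -(const (l hPlus) * sexp (pairing l h) * ssinh (pairing alpha h))) ∧
      -- failure of the symmetry `h ↦ -h`
      ((∀ (M : SmoothBase) (P : Type) [AddCommGroup P] [Module M.Fun P] [Module.Finite M.Fun P]
        [Module.Projective M.Fun P] (h : APt M P),
        phi w l (expA (-h)) = phi w l (expA h)) ↔ l hPlus = 0) ∧
      -- the `c`-function along `h₀ = c₊ h⁺ + c₋ h⁻` in `𝔞_ℝ`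
      (∀ cp cm : ℝ,
        ((∃ c : ℂ, Tendsto (cQuot w l cp cm) atTop (𝓝 c)) ↔ (l hPlus = 0 ∨ 0 ≤ cm)) ∧
        (cm = 0 → Tendsto (cQuot w l cp cm) atTop (𝓝 0)) ∧
        (0 < cm → Tendsto (cQuot w l cp cm) atTop (𝓝 (-(1 / 2) * l hPlus)))) ∧
      -- the `c`-function along `h₀ = c₊ h⁺ + c₋ h⁻` in `𝔞`
      ∃ Φ : ℂ × ℂ → ℂ, IsEntireContinuation w l Φ ∧ ∀ cp cm : ℂ,
        ((∃ c : ℂ, Tendsto (cQuotComplex Φ l cp cm) atTop (𝓝 c)) ↔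
          (l hPlus = 0 ∨ cm = 0 ∨ 0 < cm.re)) ∧
        (cm = 0 → Tendsto (cQuotComplex Φ l cp cm) atTop (𝓝 0)) ∧
        (0 < cm.re → Tendsto (cQuotComplex Φ l cp cm) atTop (𝓝 (-(1 / 2) * l hPlus))) := by
  refine ⟨negDensity, negDensity_ne_zero, negDensity_isInvariant, fun l => ⟨?_, ⟨?_, ?_⟩, ?_, ?_⟩⟩
  · exact fun M P _ _ _ _ h => phi_negDensity_expA l h
  · exact fun hsymm => hPlus_eq_zero_of_phi_expA_neg fun h => hsymm point PUnit h
  · exact fun hl M P _ _ _ _ h => phi_negDensity_expA_neg hl h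
  · intro cp cm
    rw [cQuot_negDensity]
    refine ⟨?_, fun h => tendsto_cQuotComplex_zero l cp (Or.inr (by exact_mod_cast h)),
      fun h => tendsto_cQuotComplex l cp (by simpa using h)⟩
    rw [exists_tendsto_cQuotComplex_iff, Complex.ofReal_eq_zero, Complex.ofReal_re,
      le_iff_eq_or_lt, eq_comm (a := cm)]
  · exact ⟨phiEntire l, isEntireContinuation_phiEntire l, fun cp cm =>
      ⟨exists_tendsto_cQuotComplex_iff l cp cm,
        fun h => tendsto_cQuotComplex_zero l cp (Or.inr h), fun h => tendsto_cQuotComplex l cp h⟩⟩
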